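/- **Setting.** One oscillator mode with $\hbar=1$, Hilbert space $L^2(\mathbb R)$ in the position picture, $\hat p=-i\,d/dq$, $\hat a=(\hat q+i\hat p)/\sqrt2$, $\hat n=\hat a^\dagger\hat a$ with Fock states $|n\rangle_f$, vacuum ${}_{\hat q}\langle q|0\rangle_f=\pi^{-1/4}e^{-q^2/2}$. Let $\hat X(r)=e^{-ir\hat p}$, $\hat Z(r)=e^{ir\hat q}$, $\hat V(r_1,r_2)=e^{-ir_1r_2/2}\hat Z(r_1)\hat X(r_2)$, $\hat S(\xi)=e^{i\xi(\hat q\hat p+\hat p\hat q)/2}$. Fix integers $d\ge 1$ and $0\le j<d$, put $\alpha_d=\sqrt{2\pi/d}$, and let $|j^{(\mathrm{ideal})}\rangle=\sqrt{\alpha_d d}\sum_{s\in\mathbb Z}|\alpha_d(ds+j)\rangle_{\hat q}$ (a tempered distribution, $|a\rangle_{\hat q}$ being the Dirac delta at $a$). For $\kappa,\Delta>0$, for real $\gamma,\delta$ with $0<\gamma\delta<2$, and for $\beta>0$ define $$|j^{(1)}_{\kappa,\Delta}\rangle=\frac1{\sqrt{N^{(1)}}}\sum_{s\in\mathbb Z}e^{-\frac12\kappa^2\alpha_d^2(ds+j)^2}\hat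 X(\alpha_d(ds+j))\hat S(-\ln\Delta)|0\rangle_f,$$ $$|j^{(2)}_{\gamma,\delta}\rangle=\frac1{\sqrt{N^{(2)}}}\iint\frac{dr_1dr_2}{2\pi\gamma\delta}\,e^{-\frac{r_1^2}{2\gamma^2}-\frac{r_2^2}{2\delta^2}}\hat V(r_1,r_2)|j^{(\mathrm{ideal})}\rangle,\qquad |j^{(3)}_{\beta}\rangle=\frac1{\sqrt{N^{(3)}}}e^{-\beta(\hat n+\frac12)}|j^{(\mathrm{ideal})}\rangle,$$ where $N^{(1)},N^{(2)},N^{(3)}>0$ (depending on $d$, $j$ and the parameters) normalize the states: the unnormalized expressions define nonzero vectors of $L^2(\mathbb R)$ and $N^{(i)}$ is the squared norm. The sum in the first state converges in $L^2$; the integral in the second is taken weakly against Schwartz functions; the operator in the third is $\sum_n e^{-\beta(n+1/2)}|n\rangle\langle n|_f$, with convergence in $L^2$. Let $G_\nu(x)=\frac1{\sqrt{2\pi\nu}}e^{-x^2/(2\nu)}$, $E_{\mu,\Gamma,a}(x)=e^{-x^2/(2\mu)}\sum_{s\in\mathbb Z}\delta(x-(s+a)\Gamma)$, $f*g(q)=\int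 f(y)g(q-y)\,dy$, $\vartheta\!\left[{a\atop b}\right]\!(z,\tau)=\sum_{s\in\mathbb Z}\exp[\pi i\tau(s+a)^2+2\pi i(z+b)(s+a)]$, $\lambda=1+\frac{\gamma^2\delta^2}4$ and $\rho=1-\frac{\gamma^2\delta^2}{2\lambda}$. **Proposition.** The position representations of these states are as follows (the first equality in each line being one of elements of $L^2(\mathbb R)$, i.e. for almost every $q$; the second holding for every $q\in\mathbb R$). (Approximation 1) $${}_{\hat q}\langle q|j^{(1)}_{\kappa,\Delta}\rangle=\Big(\tfrac{2\sqrt{\pi\Delta^2}}{N^{(1)}}\Big)^{\frac12}E_{\frac1{\kappa^2},\,\alpha_dd,\,\frac jd}*G_{\Delta^2}(q)=\Big(\tfrac{2\sqrt{\pi\Delta^2}}{\kappa^2dN^{(1)}}\Big)^{\frac12}G_{\frac{1+\kappa^2\Delta^2}{\kappa^2}}(q)\;\vartheta\!\left[{0\atop j/d}\right]\!\Big(-\tfrac{q}{\alpha_dd(1+\kappa^2\Delta^2)},\tfrac{i\Delta^2}{d(1+\kappa^2\Delta^2)}\Big).$$ (Approximation 2) $${}_{\hat q}\langle q|j^{(2)}_{\gamma,\delta}\rangle=\Big(\tfrac{\alpha_dd}{\lambda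 N^{(2)}}\Big)^{\frac12}E_{\frac{\lambda}{\gamma^2}\rho^2,\,\alpha_dd\rho,\,\frac jd}*G_{\frac{\delta^2}{\lambda}}(q)=\Big(\tfrac{\alpha_d\gamma^{-2}}{N^{(2)}}\Big)^{\frac12}G_{\frac{\lambda}{\gamma^2}}(q)\;\vartheta\!\left[{0\atop j/d}\right]\!\Big(-\tfrac{q\rho}{\alpha_dd},\tfrac{i\delta^2}{d\lambda}\Big).$$ (Approximation 3) $${}_{\hat q}\langle q|j^{(3)}_{\beta}\rangle=\Big(\tfrac{\alpha_dd}{\cosh\beta\,N^{(3)}}\Big)^{\frac12}E_{\frac1{\sinh\beta\cosh\beta},\,\frac{\alpha_dd}{\cosh\beta},\,\frac jd}*G_{\tanh\beta}(q)=\Big(\tfrac{\alpha_d}{\sinh\beta\,N^{(3)}}\Big)^{\frac12}G_{\frac1{\tanh\beta}}(q)\;\vartheta\!\left[{0\atop j/d}\right]\!\Big(-\tfrac{q}{\alpha_dd\cosh\beta},\tfrac{i\tanh\beta}{d}\Big).$$ -/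

import Mathlib

open MeasureTheory SchwartzMap
open scoped SchwartzMap ContDiff

namespace GKP

noncomputable section

/-! ### Operators of one oscillator mode in the position picture (`ħ = 1`)

Test states are Schwartz functions of the position variable; `𝓢'(ℝ, ℂ)` holds the
non-normalizable kets and `L2` the normalizable ones. -/

/-- The Hilbert space `L²(ℝ)` of one mode, in the position picture: the position representation
`⟨q|ψ⟩` of `ψ : L2` is the function `ψ` itself (almost everywhere defined). -/
abbrev L2 : Type := Lp ℂ 2 (volume : Measure ℝ)

/-- The position operator `q̂`, multiplication by the variable. -/
def opQ : 𝓢(ℝ, ℂ) →L[ℂ] 𝓢(ℝ, ℂ) := SchwartzMap.smulLeftCLM ℂ (fun x : ℝ => (x : ℂ))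

/-- The momentum operator `p̂ = -i d/dx`. -/
def opP : 𝓢(ℝ, ℂ) →L[ℂ] 𝓢(ℝ, ℂ) := (-Complex.I) • SchwartzMap.derivCLM ℂ ℂ

/-- The annihilation operator `â = (q̂ + i p̂)/√2`. -/
def annihilation : 𝓢(ℝ, ℂ) →L[ℂ] 𝓢(ℝ, ℂ) :=
  (((1 / √2 : ℝ)) : ℂ) • (opQ + Complex.I • opP)

/-- The creation operator `â† = (q̂ - i p̂)/√2`. -/
def creation : 𝓢(ℝ, ℂ) →L[ℂ] 𝓢(ℝ, ℂ) :=
  (((1 / √2 : ℝ)) : ℂ) • (opQ - Complex.I • opP)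

/-- The number operator `n̂ = â† â`. -/
def numberOp : 𝓢(ℝ, ℂ) →L[ℂ] 𝓢(ℝ, ℂ) := creation ∘L annihilation

/-- The displacement `X̂(r) = exp(-i r p̂)`, that is `f ↦ f(· - r)`. -/
def opX (r : ℝ) : 𝓢(ℝ, ℂ) →L[ℂ] 𝓢(ℝ, ℂ) := SchwartzMap.compSubConstCLM ℂ r

/-- The displacement `Ẑ(r) = exp(i r q̂)`, multiplication by `exp(i r x)`. -/
def opZ (r : ℝ) : 𝓢(ℝ, ℂ) →L[ℂ] 𝓢(ℝ, ℂ) :=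
  SchwartzMap.smulLeftCLM ℂ (fun x : ℝ => Complex.exp (Complex.I * (r : ℂ) * (x : ℂ)))

/-- The dilation `x ↦ exp(ξ) x` of the line. -/
def dilation (ξ : ℝ) : ℝ ≃L[ℝ] ℝ :=
  ContinuousLinearEquiv.smulLeft (Units.mk0 (Real.exp ξ) (Real.exp_pos ξ).ne')

/-- The squeezing operator `Ŝ(ξ) = exp(i ξ (q̂ p̂ + p̂ q̂)/2)`, that is
`f ↦ exp(ξ/2) f(exp(ξ) ·)`. -/
def opS (ξ : ℝ) : 𝓢(ℝ, ℂ) →L[ℂ] 𝓢(ℝ, ℂ) :=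
  ((Real.exp (ξ / 2) : ℝ) : ℂ) • SchwartzMap.compCLMOfContinuousLinearEquiv ℂ (dilation ξ)

theorem temperate_expI (r : ℝ) : Function.HasTemperateGrowth
    (fun x : ℝ => Complex.exp (Complex.I * (r : ℂ) * (x : ℂ))) := by
  have hit : ∀ n : ℕ, iteratedDeriv n
      (fun x : ℝ => Complex.exp (Complex.I * (r : ℂ) * (x : ℂ))) =
      fun x : ℝ => (Complex.I * (r : ℂ)) ^ n * Complex.exp (Complex.I * (r : ℂ) * (x : ℂ)) := by
    intro n
    induction n with
    | zero => simp
    | succ n ih =>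
      rw [iteratedDeriv_succ, ih]
      funext x
      have h1 : HasDerivAt (fun x : ℝ => Complex.I * (r : ℂ) * (x : ℂ))
          (Complex.I * (r : ℂ)) x := by
        simpa using (Complex.ofRealCLM.hasDerivAt (x := x)).const_mul (Complex.I * (r : ℂ))
      rw [((h1.cexp).const_mul ((Complex.I * (r : ℂ)) ^ n)).deriv]
      ring
  have hc : ContDiff ℝ ∞ (fun x : ℝ => Complex.exp (Complex.I * (r : ℂ) * (x : ℂ))) :=
    (contDiff_const.mul Complex.ofRealCLM.contDiff).cexp
  refine ⟨hc, fun n => ⟨0, |r| ^ n, fun x => ?_⟩⟩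
  rw [norm_iteratedFDeriv_eq_norm_iteratedDeriv, hit n]
  have : Complex.I * (r : ℂ) * (x : ℂ) = ((r * x : ℝ) : ℂ) * Complex.I := by push_cast; ring
  simp [this, Complex.norm_exp_ofReal_mul_I, -Complex.ofReal_mul]

theorem opQ_apply (f : 𝓢(ℝ, ℂ)) (x : ℝ) : opQ f x = (x : ℂ) * f x := by
  have h : Function.HasTemperateGrowth (fun x : ℝ => (x : ℂ)) :=
    Complex.ofRealCLM.hasTemperateGrowth
  simp [opQ, SchwartzMap.smulLeftCLM_apply_apply h]

theorem opP_apply (f : 𝓢(ℝ, ℂ)) (x : ℝ) : opP f x = -Complex.I * deriv f x := by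
  simp [opP]

theorem opX_apply (r : ℝ) (f : 𝓢(ℝ, ℂ)) (x : ℝ) : opX r f x = f (x - r) := rfl

theorem opZ_apply (r : ℝ) (f : 𝓢(ℝ, ℂ)) (x : ℝ) :
    opZ r f x = Complex.exp (Complex.I * (r : ℂ) * (x : ℂ)) * f x := by
  simp [opZ, SchwartzMap.smulLeftCLM_apply_apply (temperate_expI r)]

theorem opS_apply (ξ : ℝ) (f : 𝓢(ℝ, ℂ)) (x : ℝ) :
    opS ξ f x = ((Real.exp (ξ / 2) : ℝ) : ℂ) * f (Real.exp ξ * x) := by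
  simp [opS, dilation]

/-- `X̂(0) = 1` and `d/dr X̂(r) = -i p̂ X̂(r)`. -/
theorem opX_generator (f : 𝓢(ℝ, ℂ)) (x r : ℝ) : opX 0 f = f ∧
    HasDerivAt (fun t : ℝ => opX t f x) (-Complex.I * opP (opX r f) x) r := by
  refine ⟨by ext y; simp [opX_apply], ?_⟩
  have h := (f.hasDerivAt (x - r)).scomp r ((hasDerivAt_id r).const_sub x)
  have h2 : deriv (opX r f) x = deriv f (x - r) := by
    have : (opX r f : ℝ → ℂ) = fun y => f (y - r) := by funext y; rfl
    rw [this, deriv_comp_sub_const]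
  rw [opP_apply, h2]
  refine h.congr_deriv ?_
  rw [← mul_assoc]
  simp

/-- `Ẑ(0) = 1` and `d/dr Ẑ(r) = i q̂ Ẑ(r)`. -/
theorem opZ_generator (f : 𝓢(ℝ, ℂ)) (x r : ℝ) : opZ 0 f = f ∧
    HasDerivAt (fun t : ℝ => opZ t f x) (Complex.I * opQ (opZ r f) x) r := by
  refine ⟨by ext y; simp [opZ_apply], ?_⟩
  simp only [opZ_apply, opQ_apply]
  have h1 : HasDerivAt (fun t : ℝ => Complex.I * (t : ℂ) * (x : ℂ))
      (Complex.I * (x : ℂ)) r := by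
    simpa using ((Complex.ofRealCLM.hasDerivAt (x := r)).const_mul Complex.I).mul_const (x : ℂ)
  exact ((h1.cexp).mul_const (f x)).congr_deriv (by ring)

/-- `Ŝ(0) = 1` and `d/dξ Ŝ(ξ) = i ((q̂ p̂ + p̂ q̂)/2) Ŝ(ξ)`. -/
theorem opS_generator (f : 𝓢(ℝ, ℂ)) (x ξ : ℝ) : opS 0 f = f ∧
    HasDerivAt (fun t : ℝ => opS t f x)
      (Complex.I * ((opQ (opP (opS ξ f)) x + opP (opQ (opS ξ f)) x) / 2)) ξ := by
  refine ⟨by ext y; simp [opS_apply], ?_⟩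
  have hg := (opS ξ f).hasDerivAt x
  have hQ : (opQ (opS ξ f) : ℝ → ℂ) = fun y : ℝ => (y : ℂ) * opS ξ f y := by
    funext y; exact opQ_apply _ _
  have hd : deriv (opQ (opS ξ f)) x = opS ξ f x + (x : ℂ) * deriv (opS ξ f) x := by
    rw [hQ]
    have := ((Complex.ofRealCLM.hasDerivAt (x := x)).mul hg).deriv
    simp only [Complex.ofRealCLM_apply, Complex.ofReal_one, one_mul] at this
    exact this
  have hg2 : deriv (opS ξ f) x =
      ((Real.exp (ξ / 2) : ℝ) : ℂ) * (Real.exp ξ * deriv f (Real.exp ξ * x)) := by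
    have h1 : (opS ξ f : ℝ → ℂ) =
        fun y => ((Real.exp (ξ / 2) : ℝ) : ℂ) * f (Real.exp ξ * y) := by
      funext y; exact opS_apply _ _ _
    have h2 := ((f.hasDerivAt (Real.exp ξ * x)).scomp x
      ((hasDerivAt_id x).const_mul (Real.exp ξ))).const_mul ((Real.exp (ξ / 2) : ℝ) : ℂ)
    rw [h1]
    have h3 := h2.deriv
    simpa [Function.comp_def] using h3
  rw [opQ_apply, opP_apply, opP_apply, hd, hg2]
  simp only [opS_apply]
  have e1 : HasDerivAt (fun t : ℝ => ((Real.exp (t / 2) : ℝ) : ℂ))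
      (((Real.exp (ξ / 2) * (1 / 2) : ℝ)) : ℂ) ξ :=
    (((hasDerivAt_id ξ).div_const 2).exp).ofReal_comp
  have e2 := (f.hasDerivAt (Real.exp ξ * x)).scomp ξ ((Real.hasDerivAt_exp ξ).mul_const x)
  refine (e1.mul e2).congr_deriv ?_
  simp only [Function.comp_def, Complex.real_smul]
  push_cast
  linear_combination (Complex.exp (ξ / 2) * f (Real.exp ξ * x) / 2
    + Complex.exp (ξ / 2) * (x * (Complex.exp ξ * deriv f (Real.exp ξ * x)))) * Complex.I_sq

/-! ### Fock states -/

theorem gaussian_decay (k n : ℕ) : ∃ C : ℝ, ∀ x : ℝ,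
    ‖x‖ ^ k * ‖iteratedFDeriv ℝ n (fun y : ℝ => Real.exp (-(y ^ 2 / 2))) x‖ ≤ C := by
  have hpoly : ∀ p : Polynomial ℝ, ∃ C : ℝ, ∀ x : ℝ, |p.eval x * Real.exp (-(x ^ 2 / 2))| ≤ C := by
    intro p
    induction p using Polynomial.induction_on' with
    | add p q hp hq =>
      obtain ⟨C, hC⟩ := hp
      obtain ⟨D, hD⟩ := hq
      refine ⟨C + D, fun x => ?_⟩
      rw [Polynomial.eval_add, add_mul]
      exact (abs_add_le _ _).trans (add_le_add (hC x) (hD x))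
    | monomial m a =>
      refine ⟨|a| * (2 ^ m * (m.factorial : ℝ) + 1), fun x => ?_⟩
      rw [Polynomial.eval_monomial, abs_mul, abs_mul, mul_assoc, abs_of_pos (Real.exp_pos _)]
      refine mul_le_mul_of_nonneg_left ?_ (abs_nonneg a)
      rw [Real.exp_neg, ← div_eq_mul_inv, div_le_iff₀ (Real.exp_pos _)]
      have h1 := Real.pow_div_factorial_le_exp (x ^ 2 / 2) (by positivity) m
      rw [div_le_iff₀ (by positivity), div_pow, div_le_iff₀ (by positivity)] at h1
      have h2 : 1 ≤ Real.exp (x ^ 2 / 2) := Real.one_le_exp (by positivity)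
      have h3 : |x ^ m| ≤ 1 + (x ^ 2) ^ m := by
        have : (x ^ 2) ^ m = |x ^ m| ^ 2 := by rw [sq_abs]; ring
        rw [this]; nlinarith [sq_nonneg (|x ^ m| - 1), abs_nonneg (x ^ m)]
      nlinarith
  obtain ⟨C, hC⟩ := hpoly (Polynomial.X ^ k * (Polynomial.hermite n).map (Int.castRingHom ℝ))
  refine ⟨C, fun x => ?_⟩
  rw [norm_iteratedFDeriv_eq_norm_iteratedDeriv, iteratedDeriv_eq_iterate,
    Polynomial.deriv_gaussian_eq_hermite_mul_gaussian]
  have h := hC x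
  rw [Polynomial.eval_mul, Polynomial.eval_pow, Polynomial.eval_X, Polynomial.eval_map] at h
  rw [Polynomial.aeval_def]
  simpa [abs_mul, mul_assoc] using h

/-- The function `exp(-x²/2)` as a Schwartz function. -/
def gaussianS : 𝓢(ℝ, ℝ) where
  toFun := fun y : ℝ => Real.exp (-(y ^ 2 / 2))
  smooth' := by fun_prop
  decay' := gaussian_decay

/-- The vacuum state `|0⟩_f`, with `⟨x|0⟩_f = π^(-1/4) exp(-x²/2)`. -/
def vacuum : 𝓢(ℝ, ℂ) :=
  ((Real.pi ^ (-(1 / 4 : ℝ)) : ℝ) : ℂ) • SchwartzMap.postcompCLM Complex.ofRealCLM gaussianS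

theorem vacuum_apply (x : ℝ) :
    vacuum x = ((Real.pi ^ (-(1 / 4 : ℝ)) * Real.exp (-(x ^ 2 / 2)) : ℝ) : ℂ) := by
  push_cast
  simp [vacuum, gaussianS]
  left
  change ((Real.exp (-(x ^ 2 / 2)) : ℝ) : ℂ) = _
  push_cast
  rfl

/-- The Fock state `|n⟩_f = (â†)ⁿ |0⟩_f / √(n!)`. -/
def fock (n : ℕ) : 𝓢(ℝ, ℂ) :=
  ((1 / √(n.factorial : ℝ) : ℝ) : ℂ) • (creation ^ n) vacuum

theorem annihilation_apply (f : 𝓢(ℝ, ℂ)) (x : ℝ) :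
    annihilation f x = ((1 / √2 : ℝ) : ℂ) * ((x : ℂ) * f x + deriv f x) := by
  simp only [annihilation, smul_apply, add_apply, opQ_apply, opP_apply, smul_eq_mul]
  linear_combination (-((1 / √2 : ℝ) : ℂ) * deriv f x) * Complex.I_sq

theorem creation_apply (f : 𝓢(ℝ, ℂ)) (x : ℝ) :
    creation f x = ((1 / √2 : ℝ) : ℂ) * ((x : ℂ) * f x - deriv f x) := by
  simp only [creation, smul_apply, sub_apply, opQ_apply, opP_apply, smul_eq_mul]
  linear_combination (((1 / √2 : ℝ) : ℂ) * deriv f x) * Complex.I_sq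

theorem annihilation_vacuum : annihilation vacuum = 0 := by
  ext x
  have hv : (vacuum : ℝ → ℂ) =
      fun y : ℝ => ((Real.pi ^ (-(1 / 4 : ℝ)) * Real.exp (-(y ^ 2 / 2)) : ℝ) : ℂ) := by
    funext y; exact vacuum_apply y
  have hd : HasDerivAt (fun y : ℝ => Real.pi ^ (-(1 / 4 : ℝ)) * Real.exp (-(y ^ 2 / 2)))
      (Real.pi ^ (-(1 / 4 : ℝ)) * (Real.exp (-(x ^ 2 / 2)) * (-x))) x := by
    refine HasDerivAt.const_mul _ (HasDerivAt.exp ?_)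
    refine (((hasDerivAt_pow 2 x).div_const 2).neg).congr_deriv ?_
    norm_num
  rw [annihilation_apply, hv, hd.ofReal_comp.deriv]
  push_cast
  simp
  ring

theorem annihilation_creation (f : 𝓢(ℝ, ℂ)) :
    annihilation (creation f) = creation (annihilation f) + f := by
  ext x
  have hc : deriv (creation f) x =
      ((1 / √2 : ℝ) : ℂ) * (f x + x * deriv f x - deriv (deriv f) x) := by
    have h1 : (creation f : ℝ → ℂ) =
        fun y : ℝ => ((1 / √2 : ℝ) : ℂ) * ((y : ℂ) * f y - deriv f y) := by
      funext y; exact creation_apply f y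
    have h2 := ((((Complex.ofRealCLM.hasDerivAt (x := x)).mul (f.hasDerivAt x)).sub
      ((SchwartzMap.derivCLM ℂ ℂ f).hasDerivAt x)).const_mul ((1 / √2 : ℝ) : ℂ)).deriv
    simp only [Complex.ofRealCLM_apply, Complex.ofReal_one, one_mul] at h2
    rw [h1]
    exact h2
  have ha : deriv (annihilation f) x =
      ((1 / √2 : ℝ) : ℂ) * (f x + x * deriv f x + deriv (deriv f) x) := by
    have h1 : (annihilation f : ℝ → ℂ) =
        fun y : ℝ => ((1 / √2 : ℝ) : ℂ) * ((y : ℂ) * f y + deriv f y) := by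
      funext y; exact annihilation_apply f y
    have h2 := ((((Complex.ofRealCLM.hasDerivAt (x := x)).mul (f.hasDerivAt x)).add
      ((SchwartzMap.derivCLM ℂ ℂ f).hasDerivAt x)).const_mul ((1 / √2 : ℝ) : ℂ)).deriv
    simp only [Complex.ofRealCLM_apply, Complex.ofReal_one, one_mul] at h2
    rw [h1]
    exact h2
  have hs : ((1 / √2 : ℝ) : ℂ) * ((1 / √2 : ℝ) : ℂ) = 1 / 2 := by
    rw [← Complex.ofReal_mul, div_mul_div_comm, Real.mul_self_sqrt (by norm_num)]
    norm_num
  rw [add_apply, annihilation_apply, creation_apply, creation_apply, annihilation_apply, hc, ha]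
  linear_combination (2 * f x) * hs

/-- The Fock states are the eigenstates of the number operator: `n̂ |n⟩_f = n |n⟩_f`. -/
theorem numberOp_fock (n : ℕ) : numberOp (fock n) = (n : ℂ) • fock n := by
  have key : ∀ m : ℕ, numberOp ((creation ^ m) vacuum) = (m : ℂ) • (creation ^ m) vacuum := by
    intro m
    induction m with
    | zero => simp [numberOp, annihilation_vacuum]
    | succ m ih =>
      have h1 : (creation ^ (m + 1)) vacuum = creation ((creation ^ m) vacuum) := by
        rw [pow_succ']; rfl
      have h2 : creation (annihilation ((creation ^ m) vacuum)) =
          (m : ℂ) • (creation ^ m) vacuum := ih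
      rw [h1]
      change creation (annihilation (creation ((creation ^ m) vacuum))) = _
      rw [annihilation_creation, h2, map_add, map_smul]
      push_cast
      rw [add_smul, one_smul]
  rw [fock, map_smul, key, smul_comm]

/-! ### Non-normalizable kets -/

/-- The generalized position eigenket `|a⟩_q`, with `⟨x|a⟩ = δ(x - a)`. -/
def posKet (a : ℝ) : 𝓢'(ℝ, ℂ) := TemperedDistribution.delta a

/-- The displacement `X̂(r)` on generalized kets: `T ↦ T(· - r)`, so that
`(X̂(r) T)(φ) = T(φ(· + r))`. -/
def distX (r : ℝ) : 𝓢'(ℝ, ℂ) →L[ℂ] 𝓢'(ℝ, ℂ) := PointwiseConvergenceCLM.precomp ℂ (opX (-r))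

/-- The displacement `Ẑ(r)` on generalized kets: multiplication by `exp(i r x)`. -/
def distZ (r : ℝ) : 𝓢'(ℝ, ℂ) →L[ℂ] 𝓢'(ℝ, ℂ) := PointwiseConvergenceCLM.precomp ℂ (opZ r)

/-- The Weyl-Heisenberg displacement `V̂(r) = exp(-i r_p r_q/2) Ẑ(r_p) X̂(r_q)`,
`r = (r_p, r_q)`, on generalized kets. -/
def distV (r : ℝ × ℝ) (T : 𝓢'(ℝ, ℂ)) : 𝓢'(ℝ, ℂ) :=
  Complex.exp (-Complex.I * (r.1 : ℂ) * (r.2 : ℂ) / 2) • distZ r.1 (distX r.2 T)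

/-- `X̂(r) |a⟩_q = |a + r⟩_q`. -/
theorem distX_posKet (r a : ℝ) : distX r (posKet a) = posKet (a + r) := by
  ext φ
  change φ (a - -r) = φ (a + r)
  rw [sub_neg_eq_add]

/-- `Ẑ(r) |a⟩_q = exp(i r a) |a⟩_q`. -/
theorem distZ_posKet (r a : ℝ) :
    distZ r (posKet a) = Complex.exp (Complex.I * (r : ℂ) * (a : ℂ)) • posKet a := by
  ext φ
  exact opZ_apply r φ a

/-- On kets given by Schwartz functions, `distX` and `distZ` are `opX` and `opZ`. -/
theorem dist_coe (r : ℝ) (f : 𝓢(ℝ, ℂ)) :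
    distX r (f : 𝓢'(ℝ, ℂ)) = (opX r f : 𝓢(ℝ, ℂ)) ∧
    distZ r (f : 𝓢'(ℝ, ℂ)) = (opZ r f : 𝓢(ℝ, ℂ)) := by
  constructor
  · ext φ
    change (f : 𝓢'(ℝ, ℂ)) (opX (-r) φ) = _
    rw [SchwartzMap.coe_apply, SchwartzMap.coe_apply,
      ← integral_sub_right_eq_self (fun x => opX (-r) φ x • f x) r]
    simp [opX_apply]
  · ext φ
    change (f : 𝓢'(ℝ, ℂ)) (opZ r φ) = _
    rw [SchwartzMap.coe_apply, SchwartzMap.coe_apply]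
    congr 1
    funext x
    simp only [opZ_apply, smul_eq_mul]
    ring

/-- The complex conjugate of a Schwartz function. -/
def conjS (φ : 𝓢(ℝ, ℂ)) : 𝓢(ℝ, ℂ) :=
  SchwartzMap.postcompCLM (𝕜 := ℝ) (Complex.conjCLE : ℂ →L[ℝ] ℂ) φ

/-- The bracket `⟨φ|T⟩` of a Schwartz state with a generalized ket. -/
def bracket (φ : 𝓢(ℝ, ℂ)) (T : 𝓢'(ℝ, ℂ)) : ℂ := T (conjS φ)

/-- `Ψ ∈ L²` is the integral `∫ F(r) dr` of the generalized kets `F(r)`, tested on every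
Schwartz function. -/
def HasKetIntegral (F : ℝ × ℝ → 𝓢'(ℝ, ℂ)) (Ψ : L2) : Prop :=
  ∀ φ : 𝓢(ℝ, ℂ), Integrable (fun r => F r φ) ∧
    ∫ r, F r φ = (Ψ : 𝓢'(ℝ, ℂ)) φ

open Classical in
/-- The integral `∫ F(r) dr` as an element of `L²` (`0` if there is none). -/
def ketIntegral (F : ℝ × ℝ → 𝓢'(ℝ, ℂ)) : L2 :=
  if h : ∃ Ψ : L2, HasKetIntegral F Ψ then h.choose else 0

theorem HasKetIntegral.unique {F : ℝ × ℝ → 𝓢'(ℝ, ℂ)} {Ψ Φ : L2}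
    (h : HasKetIntegral F Ψ) (h' : HasKetIntegral F Φ) : Ψ = Φ := by
  have hk := Lp.ker_toTemperedDistributionCLM_eq_bot (E := ℝ) (F := ℂ)
    (μ := (volume : Measure ℝ)) (p := 2)
  refine (LinearMap.ker_eq_bot.1 hk) ?_
  ext φ
  exact ((h φ).2).symm.trans (h' φ).2

theorem HasKetIntegral.ketIntegral_eq {F : ℝ × ℝ → 𝓢'(ℝ, ℂ)} {Ψ : L2}
    (h : HasKetIntegral F Ψ) : ketIntegral F = Ψ := by
  have he : ∃ Ψ : L2, HasKetIntegral F Ψ := ⟨Ψ, h⟩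
  rw [ketIntegral, dif_pos he]
  exact he.choose_spec.unique h

theorem summable_weight {Γ : ℝ} (hΓ : Γ ≠ 0) (c : ℝ) :
    Summable (fun s : ℤ => 1 / (1 + (Γ * s + c) ^ 2)) := by
  have h := (Real.summable_one_div_int_add_rpow (c / Γ) 2).2 (by norm_num)
  have h2 := (h.mul_left (1 / Γ ^ 2)).add
    (summable_of_ne_finset_zero (f := fun s : ℤ => if (s : ℝ) + c / Γ = 0 then (1 : ℝ) else 0)
      (s := {⌊-(c / Γ)⌋}) (fun b hb => if_neg (fun h0 => hb (by
        have hb2 : (b : ℝ) = -(c / Γ) := by linarith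
        rw [Finset.mem_singleton, ← hb2, Int.floor_intCast]))))
  refine Summable.of_nonneg_of_le (fun s => by positivity) (fun s => ?_) h2
  have e : Γ * s + c = Γ * (s + c / Γ) := by field_simp
  have hr : |(s : ℝ) + c / Γ| ^ (2 : ℝ) = ((s : ℝ) + c / Γ) ^ 2 := by
    rw [Real.rpow_two, sq_abs]
  rw [e, hr]
  by_cases h0 : (s : ℝ) + c / Γ = 0
  · simp [h0]
  · rw [if_neg h0, add_zero, div_mul_div_comm, one_mul, mul_pow]
    have : 0 < Γ ^ 2 * ((s : ℝ) + c / Γ) ^ 2 := by positivity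
    exact one_div_le_one_div_of_le this (by linarith)

theorem schwartz_weight (f : 𝓢(ℝ, ℂ)) (x : ℝ) :
    ‖f x‖ ≤ (4 * ((Finset.Iic (2, 0)).sup (schwartzSeminormFamily ℂ ℝ ℂ)) f) *
      (1 / (1 + x ^ 2)) := by
  have h := SchwartzMap.one_add_le_sup_seminorm_apply (𝕜 := ℂ) (m := (2, 0)) (k := 2) (n := 0)
    le_rfl le_rfl f x
  rw [norm_iteratedFDeriv_zero, Real.norm_eq_abs] at h
  rw [mul_one_div, le_div_iff₀ (by positivity)]
  have h2 : 1 + x ^ 2 ≤ (1 + |x|) ^ 2 := by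
    nlinarith [abs_nonneg x, sq_abs x]
  calc ‖f x‖ * (1 + x ^ 2) ≤ ‖f x‖ * (1 + |x|) ^ 2 := by gcongr
    _ = (1 + |x|) ^ 2 * ‖f x‖ := mul_comm _ _
    _ ≤ _ := h
    _ = _ := by norm_num; rfl

/-- A Dirac comb converges in the space of tempered distributions. -/
theorem summable_posKet {Γ : ℝ} (hΓ : Γ ≠ 0) (c : ℝ) :
    Summable (fun s : ℤ => posKet (Γ * s + c)) := by
  have hw := summable_weight hΓ c
  have hsum : ∀ f : 𝓢(ℝ, ℂ), Summable (fun s : ℤ => f (Γ * s + c)) := fun f =>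
    Summable.of_norm_bounded (hw.mul_left _) (fun s => schwartz_weight f _)
  let A : 𝓢(ℝ, ℂ) →L[ℂ] ℂ :=
    SchwartzMap.mkCLMtoNormedSpace (𝕜 := ℂ) (σ := RingHom.id ℂ)
      (fun f => ∑' s : ℤ, f (Γ * s + c))
      (fun f g => (hsum f).tsum_add (hsum g))
      (fun a f => tsum_mul_left)
      ⟨Finset.Iic (2, 0), 4 * ∑' s : ℤ, 1 / (1 + (Γ * s + c) ^ 2),
        mul_nonneg (by norm_num) (tsum_nonneg fun s => by positivity), fun f => by
          refine (tsum_of_norm_bounded (hw.hasSum.mul_left _)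
            (fun s => schwartz_weight f _)).trans (le_of_eq ?_)
          ring⟩
  refine ⟨ContinuousLinearMap.toPointwiseConvergenceCLM _ _ _ _ A, ?_⟩
  rw [HasSum, PointwiseConvergenceCLM.tendsto_iff_forall_tendsto]
  intro f
  have h : HasSum (fun s : ℤ => f (Γ * s + c)) (A f) := (hsum f).hasSum
  refine h.congr fun t => ?_
  rw [sum_apply]
  rfl

/-! ### The ideal and the approximate GKP states -/

/-- `α_d = √(2π/d)`. -/
def alphaD (d : ℕ) : ℝ := √(2 * Real.pi / d)

/-- The ideal state `|j⟩ = √(α_d d) ∑_{s ∈ ℤ} |α_d (d s + j)⟩_q`. -/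
def ideal (d j : ℕ) : 𝓢'(ℝ, ℂ) :=
  ((√(alphaD d * d) : ℝ) : ℂ) • ∑' s : ℤ, posKet (alphaD d * (d * s + j))

/-- `|j⟩` acts on Schwartz functions by `φ ↦ √(α_d d) ∑_s φ(α_d (d s + j))`. -/
theorem hasSum_ideal {d : ℕ} (hd : d ≠ 0) (j : ℕ) (φ : 𝓢(ℝ, ℂ)) :
    HasSum (fun s : ℤ => ((√(alphaD d * d) : ℝ) : ℂ) * φ (alphaD d * (d * s + j)))
      (ideal d j φ) := by
  have h0 : alphaD d * d ≠ 0 := by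
    have : (0 : ℝ) < d := by exact_mod_cast Nat.pos_of_ne_zero hd
    have h1 : 0 < alphaD d := Real.sqrt_pos.2 (by positivity)
    positivity
  have h := summable_posKet h0 (alphaD d * j)
  simp only [show ∀ s : ℤ, alphaD d * d * s + alphaD d * j = alphaD d * (d * s + j) from
    fun s => by ring] at h
  have h2 := PointwiseConvergenceCLM.tendsto_iff_forall_tendsto.1 h.hasSum φ
  have h3 : HasSum (fun s : ℤ => φ (alphaD d * (d * s + j)))
      ((∑' s : ℤ, posKet (alphaD d * (d * s + j))) φ) := by
    refine h2.congr fun t => ?_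
    rw [sum_apply]
    rfl
  exact h3.mul_left _

/-- The `s`-th term of the superposition in Approximation 1. -/
def term1 (d j : ℕ) (κ Δ : ℝ) (s : ℤ) : L2 :=
  ((Real.exp (-(1 / 2) * κ ^ 2 * alphaD d ^ 2 * (d * s + j) ^ 2) : ℝ) : ℂ) •
    (opX (alphaD d * (d * s + j)) (opS (-Real.log Δ) vacuum)).toLp 2 volume

/-- Approximation 1 before normalization. -/
def unnormalized1 (d j : ℕ) (κ Δ : ℝ) : L2 := ∑' s : ℤ, term1 d j κ Δ s

/-- The integrand of Approximation 2, `r = (r₁, r₂) = (r_p, r_q)`. -/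
def integrand2 (d j : ℕ) (γ δ : ℝ) (r : ℝ × ℝ) : 𝓢'(ℝ, ℂ) :=
  ((1 / (2 * Real.pi * γ * δ) *
    Real.exp (-(r.1 ^ 2 / (2 * γ ^ 2)) - r.2 ^ 2 / (2 * δ ^ 2)) : ℝ) : ℂ) •
    distV r (ideal d j)

/-- Approximation 2 before normalization. -/
def unnormalized2 (d j : ℕ) (γ δ : ℝ) : L2 := ketIntegral (integrand2 d j γ δ)

/-- The `n`-th term of the Fock expansion of `exp(-β (n̂ + 1/2)) |j⟩`, namely
`exp(-β (n + 1/2)) ⟨n|j⟩ |n⟩`. -/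
def term3 (d j : ℕ) (β : ℝ) (n : ℕ) : L2 :=
  (((Real.exp (-β * (n + 1 / 2)) : ℝ) : ℂ) * bracket (fock n) (ideal d j)) • (fock n).toLp 2 volume

/-- Approximation 3 before normalization, `exp(-β (n̂ + 1/2)) |j⟩`. -/
def unnormalized3 (d j : ℕ) (β : ℝ) : L2 := ∑' n : ℕ, term3 d j β n

/-- The normalization constants `N^(1)`, `N^(2)`, `N^(3)`. -/
def N1 (d j : ℕ) (κ Δ : ℝ) : ℝ := ‖unnormalized1 d j κ Δ‖ ^ 2
def N2 (d j : ℕ) (γ δ : ℝ) : ℝ := ‖unnormalized2 d j γ δ‖ ^ 2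
def N3 (d j : ℕ) (β : ℝ) : ℝ := ‖unnormalized3 d j β‖ ^ 2

/-- The approximate state `|j^(1)_{κ,Δ}⟩`. -/
def ket1 (d j : ℕ) (κ Δ : ℝ) : L2 :=
  ((1 / √(N1 d j κ Δ) : ℝ) : ℂ) • unnormalized1 d j κ Δ

/-- The approximate state `|j^(2)_{γ,δ}⟩`. -/
def ket2 (d j : ℕ) (γ δ : ℝ) : L2 :=
  ((1 / √(N2 d j γ δ) : ℝ) : ℂ) • unnormalized2 d j γ δ

/-- The approximate state `|j^(3)_β⟩`. -/
def ket3 (d j : ℕ) (β : ℝ) : L2 :=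
  ((1 / √(N3 d j β) : ℝ) : ℂ) • unnormalized3 d j β

/-! ### The functions in the position representations -/

/-- The Gaussian density `G_ν` of variance `ν`. -/
def gauss (ν x : ℝ) : ℝ := 1 / √(2 * Real.pi * ν) * Real.exp (-(x ^ 2 / (2 * ν)))

/-- The weighted Dirac comb `E_{μ,Γ,a}(x) = exp(-x²/(2μ)) ∑_{s ∈ ℤ} δ(x - (s + a) Γ)`, as a
measure. -/
def combE (μ Γ a : ℝ) : Measure ℝ :=
  (Measure.sum fun s : ℤ => Measure.dirac ((s + a) * Γ)).withDensity
    fun x => ENNReal.ofReal (Real.exp (-(x ^ 2 / (2 * μ))))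

/-- The convolution `E * g (q) = ∫ g(q - y) dE(y)` of a measure and a function. -/
def conv (E : Measure ℝ) (g : ℝ → ℝ) (q : ℝ) : ℝ := ∫ y, g (q - y) ∂E

/-- The theta function with characteristics `a`, `b`. -/
def theta (a b : ℝ) (z τ : ℂ) : ℂ :=
  ∑' s : ℤ, Complex.exp (Real.pi * Complex.I * τ * (s + a) ^ 2 +
    2 * Real.pi * Complex.I * (z + b) * (s + a))

/-- `λ(γ, δ) = 1 + γ² δ²/4`. -/
def lam (γ δ : ℝ) : ℝ := 1 + γ ^ 2 * δ ^ 2 / 4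

end

end GKP

namespace GKP

/-!
Each of the three constructions turns a position ket `|x⟩` into a multiple of a Gaussian
`exp(-(ρx)²/(2μ)) G_ν(q - ρx)` in the position representation: the displaced squeezed vacuum is
such a Gaussian, the Gaussian average of displacements is computed by completing a square, and the
kernel of `exp(-β (n̂ + 1/2))` is Mehler's. Superposing over the lattice `x = (s + a) Γ` gives a
multiple of `E * G_ν` with the rescaled lattice, the interchange of sums and integrals being
absolutely convergent. Poisson summation turns `E * G_ν` into a Gaussian times a theta function.
-/

/-! ### Gaussian combs and theta functions -/

theorem gauss_pos {ν : ℝ} (hν : 0 < ν) (x : ℝ) : 0 < gauss ν x := by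
  unfold gauss; positivity

theorem gauss_le {ν : ℝ} (hν : 0 < ν) (x : ℝ) : gauss ν x ≤ 1 / √(2 * Real.pi * ν) :=
  mul_le_of_le_one_right (by positivity)
    (Real.exp_le_one_iff.2 (neg_nonpos.2 (by positivity)))

theorem summable_exp_comb {μ Γ : ℝ} (hμ : 0 < μ) (hΓ : Γ ≠ 0) (a : ℝ) :
    Summable fun s : ℤ => Real.exp (-(((s + a) * Γ) ^ 2 / (2 * μ))) := by
  have hw := summable_weight (Γ := Γ / √(2 * μ)) (by positivity) (a * Γ / √(2 * μ))
  refine hw.of_nonneg_of_le (fun s => (Real.exp_pos _).le) fun s => ?_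
  have hsq : (Γ / √(2 * μ) * s + a * Γ / √(2 * μ)) ^ 2 = ((s + a) * Γ) ^ 2 / (2 * μ) := by
    rw [← Real.sq_sqrt (show 0 ≤ 2 * μ by positivity), Real.sqrt_sq (Real.sqrt_nonneg _), ← div_pow]
    ring
  rw [hsq, Real.exp_neg, ← one_div, add_comm 1]
  exact one_div_le_one_div_of_le (by positivity) (Real.add_one_le_exp _)

theorem hasSum_conv_combE {μ Γ : ℝ} (hμ : 0 < μ) (hΓ : Γ ≠ 0) {g : ℝ → ℝ} {C : ℝ}
    (hg : ∀ x, ‖g x‖ ≤ C) (a q : ℝ) :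
    HasSum (fun s : ℤ => Real.exp (-(((s + a) * Γ) ^ 2 / (2 * μ))) * g (q - (s + a) * Γ))
      (conv (combE μ Γ a) g q) := by
  set f : ℝ → ℝ := fun y => Real.exp (-(y ^ 2 / (2 * μ))) * g (q - y)
  have hconv : conv (combE μ Γ a) g q =
      ∫ y, f y ∂Measure.sum fun s : ℤ => Measure.dirac (((s : ℝ) + a) * Γ) := by
    rw [conv, combE, integral_withDensity_eq_integral_toReal_smul (by fun_prop) (by simp)]
    simp only [ENNReal.toReal_ofReal (Real.exp_pos _).le, smul_eq_mul, f]
  have hs : Summable fun s : ℤ => ‖f ((s + a) * Γ)‖ := by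
    refine ((summable_exp_comb hμ hΓ a).mul_right C).of_nonneg_of_le
      (fun s => norm_nonneg _) fun s => ?_
    rw [norm_mul, Real.norm_of_nonneg (Real.exp_pos _).le]
    exact mul_le_mul_of_nonneg_left (hg _) (Real.exp_pos _).le
  have hi := hasSum_integral_measure (integrable_sum_measure
    (μ := fun s : ℤ => Measure.dirac (((s : ℝ) + a) * Γ)) (f := f)
    (fun s => integrable_dirac enorm_lt_top) (by simpa only [integral_dirac] using hs))
  simpa only [hconv, integral_dirac] using hi

theorem hasSum_conv_combE_gauss {μ ν Γ : ℝ} (hμ : 0 < μ) (hν : 0 < ν) (hΓ : Γ ≠ 0) (a q : ℝ) :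
    HasSum (fun s : ℤ => Real.exp (-(((s + a) * Γ) ^ 2 / (2 * μ))) * gauss ν (q - (s + a) * Γ))
      (conv (combE μ Γ a) (gauss ν) q) :=
  hasSum_conv_combE hμ hΓ
    (fun x => (Real.norm_of_nonneg (gauss_pos hν x).le).trans_le (gauss_le hν x)) a q

theorem conv_combE_gauss_pos {μ ν Γ : ℝ} (hμ : 0 < μ) (hν : 0 < ν) (hΓ : Γ ≠ 0) (a q : ℝ) :
    0 < conv (combE μ Γ a) (gauss ν) q := by
  have h := hasSum_conv_combE_gauss hμ hν hΓ a q
  have h0 : ∀ s : ℤ, 0 < Real.exp (-(((s + a) * Γ) ^ 2 / (2 * μ))) *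
      gauss ν (q - (s + a) * Γ) := fun s => mul_pos (Real.exp_pos _) (gauss_pos hν _)
  rw [← h.tsum_eq]
  exact h.summable.tsum_pos (fun s => (h0 s).le) 0 (h0 0)

/-- Poisson summation, i.e. the modular transformation `t ↦ 1/t` of the theta function. -/
theorem theta_eq_tsum {t : ℝ} (ht : 0 < t) (b z : ℝ) :
    theta 0 b z (Complex.I * t) =
      ((1 / √t * ∑' n : ℤ, Real.exp (-(Real.pi / t * (n + b + z) ^ 2)) : ℝ) : ℂ) := by
  have hpoisson := Complex.tsum_exp_neg_quadratic (a := (t : ℂ)) (by simpa using ht)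
    (Complex.I * ((z : ℂ) + b))
  have hleft : theta 0 b z (Complex.I * t) = ∑' n : ℤ, Complex.exp
      (-Real.pi * (t : ℂ) * (n : ℂ) ^ 2 + 2 * Real.pi * (Complex.I * ((z : ℂ) + b)) * n) := by
    refine tsum_congr fun n => congrArg Complex.exp ?_
    push_cast
    linear_combination (Real.pi * (t : ℂ) * n ^ 2) * Complex.I_sq
  have hsqrt : (t : ℂ) ^ (1 / 2 : ℂ) = (√t : ℝ) := by
    rw [Real.sqrt_eq_rpow, Complex.ofReal_cpow ht.le]
    norm_num
  rw [hleft, hpoisson, hsqrt, Complex.ofReal_mul, Complex.ofReal_tsum, ← (Equiv.neg ℤ).tsum_eq]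
  push_cast
  congr 1
  refine tsum_congr fun n => congrArg Complex.exp ?_
  rw [Equiv.neg_apply, Int.cast_neg]
  linear_combination (Real.pi / (t : ℂ) * ((z : ℂ) + b) *
    (2 * n + ((z : ℂ) + b) * (1 - Complex.I ^ 2))) * Complex.I_sq

theorem exp_mul_gauss_sub {μ ν : ℝ} (hμ : 0 < μ) (hν : 0 < ν) (x q : ℝ) :
    Real.exp (-(x ^ 2 / (2 * μ))) * gauss ν (q - x) =
      √((μ + ν) / ν) * gauss (μ + ν) q *
        Real.exp (-((μ + ν) / (2 * (μ * ν)) * (x - q * μ / (μ + ν)) ^ 2)) := by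
  have hsquare : Real.exp (-(x ^ 2 / (2 * μ))) * Real.exp (-((q - x) ^ 2 / (2 * ν))) =
      Real.exp (-(q ^ 2 / (2 * (μ + ν)))) *
        Real.exp (-((μ + ν) / (2 * (μ * ν)) * (x - q * μ / (μ + ν)) ^ 2)) := by
    rw [← Real.exp_add, ← Real.exp_add]
    congr 1
    field_simp
    ring
  have hscale : 1 / √(2 * Real.pi * ν) = √((μ + ν) / ν) * (1 / √(2 * Real.pi * (μ + ν))) := by
    rw [one_div, one_div, ← Real.sqrt_inv, ← Real.sqrt_inv, ← Real.sqrt_mul (by positivity)]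
    congr 1
    field_simp
  rw [gauss, gauss, hscale]
  linear_combination (√((μ + ν) / ν) * (1 / √(2 * Real.pi * (μ + ν)))) * hsquare

theorem conv_combE_gauss_eq_theta {μ ν Γ : ℝ} (hμ : 0 < μ) (hν : 0 < ν) (hΓ : Γ ≠ 0) (a q : ℝ) :
    ((conv (combE μ Γ a) (gauss ν) q : ℝ) : ℂ) =
      ((√(2 * Real.pi * μ / Γ ^ 2) * gauss (μ + ν) q : ℝ) : ℂ) *
        theta 0 a ((-(q * μ / ((μ + ν) * Γ)) : ℝ) : ℂ)
          (Complex.I * ((2 * Real.pi * (μ * ν) / ((μ + ν) * Γ ^ 2) : ℝ) : ℂ)) := by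
  have hterm : ∀ s : ℤ, Real.exp (-(((s + a) * Γ) ^ 2 / (2 * μ))) * gauss ν (q - (s + a) * Γ) =
      √((μ + ν) / ν) * gauss (μ + ν) q *
        Real.exp (-(Real.pi / (2 * Real.pi * (μ * ν) / ((μ + ν) * Γ ^ 2)) *
          (s + a + -(q * μ / ((μ + ν) * Γ))) ^ 2)) := fun s => by
    rw [exp_mul_gauss_sub hμ hν]
    congr 3
    field_simp
    ring
  have hscale : √((μ + ν) / ν) = √(2 * Real.pi * μ / Γ ^ 2) *
      (1 / √(2 * Real.pi * (μ * ν) / ((μ + ν) * Γ ^ 2))) := by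
    rw [one_div, ← Real.sqrt_inv, ← Real.sqrt_mul (by positivity)]
    congr 1
    field_simp
  rw [theta_eq_tsum (by positivity), ← (hasSum_conv_combE_gauss hμ hν hΓ a q).tsum_eq,
    ← Complex.ofReal_mul, tsum_congr hterm, tsum_mul_left, hscale]
  congr 1
  ring

theorem sqrt_mul_conv_eq_theta {μ ν Γ σ A K : ℝ} (hμ : 0 < μ) (hν : 0 < ν) (hΓ : Γ ≠ 0)
    (hA : 0 ≤ A) (a q : ℝ) {z t : ℝ} (hσ : μ + ν = σ) (hK : A * (2 * Real.pi * μ) = K * Γ ^ 2)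
    (hz : q * μ / (σ * Γ) = z) (ht : 2 * Real.pi * (μ * ν) / (σ * Γ ^ 2) = t) :
    ((√A * conv (combE μ Γ a) (gauss ν) q : ℝ) : ℂ) =
      ((√K * gauss σ q : ℝ) : ℂ) * theta 0 a ((-z : ℝ) : ℂ) (Complex.I * (t : ℂ)) := by
  have hK' : √K = √A * √(2 * Real.pi * μ / Γ ^ 2) := by
    rw [← Real.sqrt_mul hA, ← mul_div_assoc, hK, mul_div_cancel_right₀ _ (pow_ne_zero 2 hΓ)]
  subst hσ hz ht
  rw [Complex.ofReal_mul, conv_combE_gauss_eq_theta hμ hν hΓ, hK']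
  push_cast
  ring

/-! ### Gaussian combs as kets -/

theorem ae_eq_of_hasSum {ι α E : Type*} [Countable ι] [MeasurableSpace α] {μ : Measure α}
    [NormedAddCommGroup E] {p : ENNReal} [Fact (1 ≤ p)] {f : ι → Lp E p μ} {F : Lp E p μ}
    (h : HasSum f F) {g : ι → α → E} {G : α → E} (hg : ∀ i, f i =ᵐ[μ] g i)
    (hG : ∀ x, HasSum (fun i => g i x) (G x)) : F =ᵐ[μ] G := by
  obtain ⟨ns, hns, hae⟩ := (tendstoInMeasure_of_tendsto_Lp h).exists_seq_tendsto_ae'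
  have hsum : ∀ s : Finset ι, (∑ i ∈ s, f i : Lp E p μ) =ᵐ[μ] fun x => ∑ i ∈ s, g i x := by
    intro s
    refine (Lp.coeFn_finsetSum s f).trans ?_
    filter_upwards [ae_all_iff.2 hg] with x hx
    simp [hx]
  filter_upwards [hae, ae_all_iff.2 hsum] with x hseq hsums
  exact tendsto_nhds_unique hseq (((hG x).comp hns).congr fun n => (hsums _).symm)

theorem opS_neg_log_vacuum_apply {w : ℝ} (hw : 0 < w) (x : ℝ) :
    opS (-Real.log w) vacuum x = ((√(2 * √(Real.pi * w ^ 2)) * gauss (w ^ 2) x : ℝ) : ℂ) := by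
  have hexp : Real.exp (-Real.log w) = w⁻¹ := by rw [Real.exp_neg, Real.exp_log hw]
  have hexp_half : Real.exp (-Real.log w / 2) = √(w⁻¹) := by rw [← hexp, ← Real.exp_half]
  have hpi : Real.pi ^ (-(1 / 4 : ℝ)) = √(√(Real.pi⁻¹)) := by
    rw [Real.sqrt_eq_rpow, Real.sqrt_eq_rpow, ← Real.rpow_mul (by positivity),
      Real.inv_rpow Real.pi_pos.le, ← Real.rpow_neg Real.pi_pos.le]
    norm_num
  have hscale : √(w⁻¹) * √√(Real.pi⁻¹) =
      √(2 * √(Real.pi * w ^ 2)) * (1 / √(2 * Real.pi * w ^ 2)) := by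
    rw [one_div, ← Real.sqrt_inv, ← Real.sqrt_mul (by positivity), ← Real.sqrt_mul (by positivity)]
    congr 1
    rw [Real.sqrt_mul Real.pi_pos.le, Real.sqrt_sq hw.le, Real.sqrt_inv]
    field_simp
    linear_combination -Real.sq_sqrt Real.pi_pos.le
  have hgauss : Real.exp (-((w⁻¹ * x) ^ 2 / 2)) = Real.exp (-(x ^ 2 / (2 * w ^ 2))) := by
    congr 1
    field_simp
  rw [opS_apply, vacuum_apply, ← Complex.ofReal_mul, hexp, hexp_half, hpi, gauss, ← mul_assoc,
    ← mul_assoc, hscale, ← hgauss]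

theorem norm_toLp_opX (c : ℝ) (f : 𝓢(ℝ, ℂ)) :
    ‖(opX c f).toLp 2 volume‖ = ‖f.toLp 2 volume‖ := by
  rw [SchwartzMap.norm_toLp, SchwartzMap.norm_toLp]
  exact congrArg _ (eLpNorm_comp_measurePreserving f.continuous.aestronglyMeasurable
    (measurePreserving_sub_right volume c))

/-- The Gaussian density of variance `ν` centred at `c`, as a vector of `L²`. It is built as a
displaced squeezed vacuum, which is how it occurs in Approximation 1. -/
noncomputable def gaussKet (ν c : ℝ) : L2 :=
  (((√(2 * √(Real.pi * ν)))⁻¹ : ℝ) : ℂ) • (opX c (opS (-Real.log √ν) vacuum)).toLp 2 volume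

theorem gaussKet_ae_eq {ν : ℝ} (hν : 0 < ν) (c : ℝ) :
    gaussKet ν c =ᵐ[volume] fun q => ((gauss ν (q - c) : ℝ) : ℂ) := by
  filter_upwards [Lp.coeFn_smul (((√(2 * √(Real.pi * ν)))⁻¹ : ℝ) : ℂ)
      ((opX c (opS (-Real.log √ν) vacuum)).toLp 2 volume),
    SchwartzMap.coeFn_toLp (opX c (opS (-Real.log √ν) vacuum)) 2 volume] with q hsmul hq
  rw [gaussKet, hsmul, Pi.smul_apply, hq, opX_apply,
    opS_neg_log_vacuum_apply (Real.sqrt_pos.2 hν), Real.sq_sqrt hν.le, smul_eq_mul,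
    ← Complex.ofReal_mul, inv_mul_cancel_left₀ (by positivity)]

theorem norm_gaussKet (ν c : ℝ) : ‖gaussKet ν c‖ = ‖gaussKet ν 0‖ := by
  simp only [gaussKet, norm_smul, norm_toLp_opX]

/-- The position ket `|x⟩` smeared to a Gaussian of variance `ν` and damped by the envelope
`exp(-x²/(2μ))`: the contribution of the lattice point `x` to `E_{μ,Γ,a} * G_ν`. -/
noncomputable def smearedKet (μ ν x : ℝ) : L2 :=
  ((Real.exp (-(x ^ 2 / (2 * μ))) : ℝ) : ℂ) • gaussKet ν x

theorem smearedKet_ae_eq (μ : ℝ) {ν : ℝ} (hν : 0 < ν) (x : ℝ) :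
    smearedKet μ ν x =ᵐ[volume]
      fun q => ((Real.exp (-(x ^ 2 / (2 * μ))) * gauss ν (q - x) : ℝ) : ℂ) := by
  filter_upwards [gaussKet_ae_eq hν x,
    Lp.coeFn_smul ((Real.exp (-(x ^ 2 / (2 * μ))) : ℝ) : ℂ) (gaussKet ν x)] with q hq hsmul
  rw [smearedKet, hsmul, Pi.smul_apply, hq, smul_eq_mul, ← Complex.ofReal_mul]

/-- The comb `E_{μ,Γ,a} * G_ν` as a vector of `L²`. -/
noncomputable def gaussComb (μ ν Γ a : ℝ) : L2 := ∑' s : ℤ, smearedKet μ ν ((s + a) * Γ)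

theorem hasSum_gaussComb {μ Γ : ℝ} (hμ : 0 < μ) (hΓ : Γ ≠ 0) (ν a : ℝ) :
    HasSum (fun s : ℤ => smearedKet μ ν ((s + a) * Γ)) (gaussComb μ ν Γ a) := by
  refine (Summable.of_norm (((summable_exp_comb hμ hΓ a).mul_right ‖gaussKet ν 0‖).congr
    fun s => ?_)).hasSum
  rw [smearedKet, norm_smul, norm_gaussKet ν ((s + a) * Γ), Complex.norm_real,
    Real.norm_of_nonneg (Real.exp_pos _).le]

theorem gaussComb_ae_eq {μ ν Γ : ℝ} (hμ : 0 < μ) (hν : 0 < ν) (hΓ : Γ ≠ 0) (a : ℝ) :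
    gaussComb μ ν Γ a =ᵐ[volume] fun q => ((conv (combE μ Γ a) (gauss ν) q : ℝ) : ℂ) :=
  ae_eq_of_hasSum (hasSum_gaussComb hμ hΓ ν a) (fun _ => smearedKet_ae_eq μ hν _)
    fun q => Complex.hasSum_ofReal.2 (hasSum_conv_combE_gauss hμ hν hΓ a q)

theorem gaussComb_ne_zero {μ ν Γ : ℝ} (hμ : 0 < μ) (hν : 0 < ν) (hΓ : Γ ≠ 0) (a : ℝ) :
    gaussComb μ ν Γ a ≠ 0 := fun h => by
  obtain ⟨q, hq⟩ := ((gaussComb_ae_eq hμ hν hΓ a).symm.trans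
    (h ▸ Lp.coeFn_zero ℂ 2 (volume : Measure ℝ))).exists
  exact (conv_combE_gauss_pos hμ hν hΓ a q).ne' (Complex.ofReal_eq_zero.1 hq)

theorem normalize_gaussComb {μ ν Γ A : ℝ} (hμ : 0 < μ) (hν : 0 < ν) (hΓ : Γ ≠ 0) (hA : 0 < A)
    {a : ℝ} {u : L2} (hu : u = ((√A : ℝ) : ℂ) • gaussComb μ ν Γ a) :
    0 < ‖u‖ ^ 2 ∧ ‖((1 / √(‖u‖ ^ 2) : ℝ) : ℂ) • u‖ = 1 ∧
      ∀ᵐ q : ℝ, (((1 / √(‖u‖ ^ 2) : ℝ) : ℂ) • u : L2) q =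
        ((√(A / ‖u‖ ^ 2) * conv (combE μ Γ a) (gauss ν) q : ℝ) : ℂ) := by
  have hA' : ((√A : ℝ) : ℂ) ≠ 0 := by exact_mod_cast (Real.sqrt_pos.2 hA).ne'
  have hpos : 0 < ‖u‖ := norm_pos_iff.2 (hu ▸ smul_ne_zero hA' (gaussComb_ne_zero hμ hν hΓ a))
  have hcoeff : ((1 / √(‖u‖ ^ 2) : ℝ) : ℂ) • u =
      ((√(A / ‖u‖ ^ 2) : ℝ) : ℂ) • gaussComb μ ν Γ a := by
    conv_lhs => rw [hu, smul_smul, ← hu, ← Complex.ofReal_mul]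
    rw [one_div_mul_eq_div, Real.sqrt_div hA.le]
  refine ⟨by positivity, ?_, ?_⟩
  · rw [norm_smul, Real.sqrt_sq hpos.le, Complex.norm_real, Real.norm_of_nonneg (by positivity),
      one_div_mul_cancel hpos.ne']
  · rw [hcoeff]
    filter_upwards [gaussComb_ae_eq hμ hν hΓ a, Lp.coeFn_smul ((√(A / ‖u‖ ^ 2) : ℝ) : ℂ)
      (gaussComb μ ν Γ a)] with q hq hsmul
    rw [hsmul, Pi.smul_apply, hq, smul_eq_mul, ← Complex.ofReal_mul]

/-! ### The ideal state and Approximation 1 -/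

theorem alphaD_pos {d : ℕ} (hd : 0 < d) : 0 < alphaD d := by
  unfold alphaD; positivity

theorem alphaD_sq_mul {d : ℕ} (hd : 0 < d) : alphaD d ^ 2 * d = 2 * Real.pi := by
  rw [alphaD, Real.sq_sqrt (by positivity), div_mul_cancel₀ _ (by positivity)]

/-- `T` is the Dirac comb `c ∑ₛ |(s + a) Γ⟩`, the sum being tested on Schwartz functions. -/
def IsDiracComb (c : ℂ) (Γ a : ℝ) (T : 𝓢'(ℝ, ℂ)) : Prop :=
  ∀ φ : 𝓢(ℝ, ℂ), HasSum (fun s : ℤ => c * φ ((s + a) * Γ)) (T φ)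

theorem isDiracComb_ideal {d : ℕ} (hd : 0 < d) (j : ℕ) :
    IsDiracComb (√(alphaD d * d) : ℝ) (alphaD d * d) (j / d) (ideal d j) := fun φ => by
  refine (hasSum_ideal hd.ne' j φ).congr_fun fun s => ?_
  rw [show ((s : ℝ) + j / d) * (alphaD d * d) = alphaD d * (d * s + j) by field_simp]

theorem term1_eq_smul_smearedKet {d : ℕ} (hd : 0 < d) (j : ℕ) {κ Δ : ℝ} (hΔ : 0 < Δ) (s : ℤ) :
    term1 d j κ Δ s = ((√(2 * √(Real.pi * Δ ^ 2)) : ℝ) : ℂ) •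
      smearedKet (1 / κ ^ 2) (Δ ^ 2) ((s + j / d) * (alphaD d * d)) := by
  have hpoint : ((s : ℝ) + j / d) * (alphaD d * d) = alphaD d * (d * s + j) := by field_simp
  have hexp : Real.exp (-(1 / 2) * κ ^ 2 * alphaD d ^ 2 * (d * s + j) ^ 2) =
      Real.exp (-((alphaD d * (d * s + j)) ^ 2 / (2 * (1 / κ ^ 2)))) := by
    congr 1
    field_simp
  rw [term1, smearedKet, gaussKet, hpoint, Real.sqrt_sq hΔ.le, smul_comm, smul_smul, smul_smul,
    ← Complex.ofReal_mul, ← Complex.ofReal_mul, mul_inv_cancel_right₀ (by positivity), hexp]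

theorem hasSum_term1 {d : ℕ} (hd : 0 < d) (j : ℕ) {κ Δ : ℝ} (hκ : κ ≠ 0) (hΔ : 0 < Δ) :
    HasSum (term1 d j κ Δ) (((√(2 * √(Real.pi * Δ ^ 2)) : ℝ) : ℂ) •
      gaussComb (1 / κ ^ 2) (Δ ^ 2) (alphaD d * d) (j / d)) := by
  have hα := alphaD_pos hd
  rw [funext (term1_eq_smul_smearedKet hd j hΔ)]
  exact (hasSum_gaussComb (by positivity) (by positivity) _ _).const_smul _

/-! ### Approximation 2: Gaussian averages of displacements -/

theorem gauss_eq_gaussianPDFReal {ν : ℝ} (hν : 0 ≤ ν) :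
    gauss ν = ProbabilityTheory.gaussianPDFReal 0 ν.toNNReal := by
  funext x
  rw [gauss, ProbabilityTheory.gaussianPDFReal, Real.coe_toNNReal ν hν, one_div, sub_zero, neg_div]

theorem integrable_one_add_sq_mul_gauss {ν : ℝ} (hν : 0 < ν) :
    Integrable fun x => (1 + x ^ 2) * gauss ν x := by
  have h0 : Integrable (gauss ν) := by
    rw [gauss_eq_gaussianPDFReal hν.le]
    exact ProbabilityTheory.integrable_gaussianPDFReal _ _
  have h2 := (integrable_rpow_mul_exp_neg_mul_sq (b := 1 / (2 * ν)) (by positivity)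
    (s := 2) (by norm_num)).const_mul (1 / √(2 * Real.pi * ν))
  refine (h0.add h2).congr (ae_of_all _ fun x => ?_)
  simp only [Pi.add_apply, gauss, Real.rpow_two]
  rw [show -(1 / (2 * ν)) * x ^ 2 = -(x ^ 2 / (2 * ν)) by ring]
  ring

theorem integral_gauss_mul_cexp {ν : ℝ} (hν : 0 < ν) (u : ℝ) :
    ∫ r : ℝ, ((gauss ν r : ℝ) : ℂ) * Complex.exp (u * r * Complex.I) =
      ((Real.exp (-(ν * u ^ 2 / 2)) : ℝ) : ℂ) := by
  have h := ProbabilityTheory.charFun_gaussianReal (μ := 0) (v := ν.toNNReal) u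
  rw [charFun_apply_real, ProbabilityTheory.integral_gaussianReal_eq_integral_smul
    (Real.toNNReal_pos.2 hν).ne', ← gauss_eq_gaussianPDFReal hν.le, Real.coe_toNNReal ν hν.le] at h
  simpa only [Complex.real_smul, Complex.ofReal_zero, mul_zero, zero_mul, zero_sub,
    Complex.ofReal_exp, Complex.ofReal_neg, Complex.ofReal_div, Complex.ofReal_mul,
    Complex.ofReal_pow, Complex.ofReal_ofNat] using h

theorem one_div_one_add_add_sq_le (a r : ℝ) :
    1 / (1 + (a + r) ^ 2) ≤ 2 * (1 + r ^ 2) * (1 / (1 + a ^ 2)) := by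
  rw [mul_one_div, div_le_div_iff₀ (by positivity) (by positivity)]
  nlinarith [sq_nonneg (a + 2 * r), sq_nonneg (r * (a + r)), sq_nonneg r]

theorem HasKetIntegral.const_smul {F : ℝ × ℝ → 𝓢'(ℝ, ℂ)} {Ψ : L2} (h : HasKetIntegral F Ψ)
    (c : ℂ) : HasKetIntegral (fun r => c • F r) (c • Ψ) := fun φ => by
  refine ⟨(h φ).1.const_mul c, ?_⟩
  have hmap := congrArg (fun T : 𝓢'(ℝ, ℂ) => T φ)
    (map_smul (Lp.toTemperedDistributionCLM ℂ (volume : Measure ℝ) 2) c Ψ)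
  exact (integral_const_mul c _).trans ((congrArg (c * ·) (h φ).2).trans hmap.symm)

theorem hasSum_toTemperedDistribution_apply {ι : Type*} {f : ι → L2} {Ψ : L2} (h : HasSum f Ψ)
    (φ : 𝓢(ℝ, ℂ)) : HasSum (fun i => (f i : 𝓢'(ℝ, ℂ)) φ) ((Ψ : 𝓢'(ℝ, ℂ)) φ) := by
  have hT := h.mapL (Lp.toTemperedDistributionCLM ℂ (volume : Measure ℝ) 2)
  refine (PointwiseConvergenceCLM.tendsto_iff_forall_tendsto.1 hT φ).congr fun t => ?_
  rw [sum_apply]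
  rfl

theorem HasKetIntegral.hasSum {ι : Type*} [Countable ι] {F : ι → ℝ × ℝ → 𝓢'(ℝ, ℂ)} {Ψ : ι → L2}
    {G : ℝ × ℝ → 𝓢'(ℝ, ℂ)} {Φ : L2} (hF : ∀ i, HasKetIntegral (F i) (Ψ i)) (hΨ : HasSum Ψ Φ)
    (hG : ∀ φ r, HasSum (fun i => F i r φ) (G r φ)) {u : ι → ℝ} (hu : Summable u)
    (hbound : ∀ φ, ∃ W : ℝ × ℝ → ℝ, Integrable W ∧ ∀ i r, ‖F i r φ‖ ≤ u i * W r) :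
    HasKetIntegral G Φ := fun φ => by
  obtain ⟨W, hW, hFW⟩ := hbound φ
  have hmeas : ∀ i, AEStronglyMeasurable (fun r => F i r φ) volume := fun i =>
    (hF i φ).1.aestronglyMeasurable
  have hGmeas : AEStronglyMeasurable (fun r => G r φ) volume :=
    aestronglyMeasurable_of_tendsto_ae (Filter.atTop : Filter (Finset ι))
      (fun t => t.aestronglyMeasurable_fun_sum fun i _ => hmeas i) (ae_of_all _ (hG φ))
  refine ⟨(hW.const_mul (∑' i, u i)).mono' hGmeas (ae_of_all _ fun r => ?_), ?_⟩
  · rw [← (hG φ r).tsum_eq]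
    exact tsum_of_norm_bounded (hu.hasSum.mul_right _) fun i => hFW i r
  · have hint := hasSum_integral_of_dominated_convergence (fun i r => u i * W r) hmeas
      (fun i => ae_of_all _ (hFW i)) (ae_of_all _ fun r => hu.mul_right _)
      (by simpa only [tsum_mul_right] using hW.const_mul _) (ae_of_all _ (hG φ))
    refine hint.unique ?_
    simpa only [(hF _ φ).2] using hasSum_toTemperedDistribution_apply hΨ φ

/-- The integrand of Approximation 2 with a general state `T` in place of the ideal one. -/
noncomputable def displaced (γ δ : ℝ) (T : 𝓢'(ℝ, ℂ)) (r : ℝ × ℝ) : 𝓢'(ℝ, ℂ) :=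
  ((1 / (2 * Real.pi * γ * δ) *
    Real.exp (-(r.1 ^ 2 / (2 * γ ^ 2)) - r.2 ^ 2 / (2 * δ ^ 2)) : ℝ) : ℂ) • distV r T

theorem displaced_apply {γ δ : ℝ} (h : 0 < γ * δ) (T : 𝓢'(ℝ, ℂ)) (r : ℝ × ℝ) (φ : 𝓢(ℝ, ℂ)) :
    displaced γ δ T r φ = (((gauss (γ ^ 2) r.1 * gauss (δ ^ 2) r.2 : ℝ) : ℂ) *
      Complex.exp (-Complex.I * r.1 * r.2 / 2)) * T (opX (-r.2) (opZ r.1 φ)) := by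
  have hnorm : √(2 * Real.pi * γ ^ 2) * √(2 * Real.pi * δ ^ 2) = 2 * Real.pi * γ * δ := by
    rw [← Real.sqrt_mul (by positivity),
      show 2 * Real.pi * γ ^ 2 * (2 * Real.pi * δ ^ 2) = (2 * Real.pi * (γ * δ)) ^ 2 by ring,
      Real.sqrt_sq (by positivity)]
    ring
  have hweight : 1 / (2 * Real.pi * γ * δ) *
      Real.exp (-(r.1 ^ 2 / (2 * γ ^ 2)) - r.2 ^ 2 / (2 * δ ^ 2)) =
        gauss (γ ^ 2) r.1 * gauss (δ ^ 2) r.2 := by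
    rw [gauss, gauss, sub_eq_add_neg, Real.exp_add, ← hnorm]
    ring
  rw [displaced, hweight, mul_assoc]
  rfl

theorem displaced_posKet_apply {γ δ : ℝ} (h : 0 < γ * δ) (a : ℝ) (r : ℝ × ℝ) (φ : 𝓢(ℝ, ℂ)) :
    displaced γ δ (posKet a) r φ =
      ((gauss (γ ^ 2) r.1 : ℝ) : ℂ) * Complex.exp ((a + r.2 / 2 : ℝ) * r.1 * Complex.I) *
        (((gauss (δ ^ 2) r.2 : ℝ) : ℂ) * φ (a + r.2)) := by
  have hphase : Complex.exp ((a + r.2 / 2 : ℝ) * r.1 * Complex.I) =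
      Complex.exp (-Complex.I * r.1 * r.2 / 2) *
        Complex.exp (Complex.I * r.1 * ((a + r.2 : ℝ) : ℂ)) := by
    rw [← Complex.exp_add]
    congr 1
    push_cast
    ring
  rw [displaced_apply h, posKet, TemperedDistribution.delta_apply, opX_apply, opZ_apply,
    sub_neg_eq_add, hphase]
  push_cast
  ring

theorem exists_integrable_bound_displaced {γ δ : ℝ} (h : 0 < γ * δ) (φ : 𝓢(ℝ, ℂ)) :
    ∃ W : ℝ × ℝ → ℝ, Integrable W ∧
      ∀ a r, ‖displaced γ δ (posKet a) r φ‖ ≤ 1 / (1 + a ^ 2) * W r := by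
  have hγ : 0 < γ ^ 2 := sq_pos_of_ne_zero (left_ne_zero_of_mul h.ne')
  have hδ : 0 < δ ^ 2 := sq_pos_of_ne_zero (right_ne_zero_of_mul h.ne')
  set K := 4 * ((Finset.Iic (2, 0)).sup (schwartzSeminormFamily ℂ ℝ ℂ)) φ
  have hK : 0 ≤ K := mul_nonneg (by norm_num) (apply_nonneg _ _)
  have hgauss : Integrable (gauss (γ ^ 2)) := by
    rw [gauss_eq_gaussianPDFReal hγ.le]
    exact ProbabilityTheory.integrable_gaussianPDFReal _ _
  refine ⟨fun r => 2 * K * (gauss (γ ^ 2) r.1 * ((1 + r.2 ^ 2) * gauss (δ ^ 2) r.2)),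
    (hgauss.mul_prod (integrable_one_add_sq_mul_gauss hδ)).const_mul _, fun a r => ?_⟩
  have h1 := (gauss_pos hγ r.1).le
  have h2 := (gauss_pos hδ r.2).le
  have hφ : ‖φ (a + r.2)‖ ≤ K * (2 * (1 + r.2 ^ 2) * (1 / (1 + a ^ 2))) :=
    (schwartz_weight φ (a + r.2)).trans
      (mul_le_mul_of_nonneg_left (one_div_one_add_add_sq_le a r.2) hK)
  rw [displaced_posKet_apply h, norm_mul, norm_mul, norm_mul, ← Complex.ofReal_mul,
    Complex.norm_exp_ofReal_mul_I, Complex.norm_real, Complex.norm_real, Real.norm_of_nonneg h1,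
    Real.norm_of_nonneg h2, mul_one]
  calc gauss (γ ^ 2) r.1 * (gauss (δ ^ 2) r.2 * ‖φ (a + r.2)‖)
      ≤ gauss (γ ^ 2) r.1 *
        (gauss (δ ^ 2) r.2 * (K * (2 * (1 + r.2 ^ 2) * (1 / (1 + a ^ 2))))) := by gcongr
    _ = _ := by ring

theorem integrable_displaced_posKet {γ δ : ℝ} (h : 0 < γ * δ) (φ : 𝓢(ℝ, ℂ)) (a : ℝ) :
    Integrable fun r => displaced γ δ (posKet a) r φ := by
  obtain ⟨W, hW, hbound⟩ := exists_integrable_bound_displaced h φ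
  refine (hW.const_mul _).mono' ?_ (ae_of_all _ (hbound a))
  have hφ := φ.continuous
  simp only [displaced_posKet_apply h, gauss]
  exact Continuous.aestronglyMeasurable (by fun_prop)

theorem integral_displaced_posKet {γ δ : ℝ} (h : 0 < γ * δ) (φ : 𝓢(ℝ, ℂ)) (a : ℝ) :
    ∫ r, displaced γ δ (posKet a) r φ = ∫ y : ℝ, φ y *
      ((gauss (δ ^ 2) (y - a) * Real.exp (-(γ ^ 2 * (a + y) ^ 2 / 8)) : ℝ) : ℂ) := by
  have hγ : 0 < γ ^ 2 := sq_pos_of_ne_zero (left_ne_zero_of_mul h.ne')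
  rw [Measure.volume_eq_prod, integral_prod_symm _ (integrable_displaced_posKet h φ a),
    ← integral_sub_right_eq_self _ a]
  simp only [displaced_posKet_apply h, integral_mul_const, integral_gauss_mul_cexp hγ]
  refine integral_congr_ae (ae_of_all _ fun y => ?_)
  have hexp : γ ^ 2 * (a + (y - a) / 2) ^ 2 / 2 = γ ^ 2 * (a + y) ^ 2 / 8 := by ring
  simp only [hexp, add_sub_cancel]
  push_cast
  ring

/-- The contraction factor `ρ` of the lattice in Approximation 2. -/
noncomputable def rho (γ δ : ℝ) : ℝ := 1 - γ ^ 2 * δ ^ 2 / (2 * lam γ δ)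

theorem lam_pos (γ δ : ℝ) : 0 < lam γ δ := by
  unfold lam; positivity

theorem rho_eq_div (γ δ : ℝ) : rho γ δ = (1 - γ ^ 2 * δ ^ 2 / 4) / lam γ δ := by
  have hl := lam_pos γ δ
  rw [rho, eq_div_iff hl.ne', sub_mul, div_mul_eq_mul_div, mul_div_mul_right _ _ hl.ne', lam]
  ring

theorem rho_ne_zero {γ δ : ℝ} (h0 : 0 < γ * δ) (h2 : γ * δ ≠ 2) : rho γ δ ≠ 0 := by
  rw [rho_eq_div]
  refine div_ne_zero (fun h => h2 ?_) (lam_pos γ δ).ne'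
  nlinarith

/-- Completing the square in `y`. -/
theorem displacement_kernel_eq {γ δ : ℝ} (h : 0 < γ * δ) (hρ : rho γ δ ≠ 0) (a y : ℝ) :
    gauss (δ ^ 2) (y - a) * Real.exp (-(γ ^ 2 * (a + y) ^ 2 / 8)) =
      1 / √(lam γ δ) * (Real.exp (-((a * rho γ δ) ^ 2 /
        (2 * (lam γ δ / γ ^ 2 * rho γ δ ^ 2)))) *
        gauss (δ ^ 2 / lam γ δ) (y - a * rho γ δ)) := by
  have hγ : γ ≠ 0 := left_ne_zero_of_mul h.ne'
  have hδ : δ ≠ 0 := right_ne_zero_of_mul h.ne'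
  have hl : 0 < lam γ δ := lam_pos γ δ
  have hscale : 1 / √(2 * Real.pi * δ ^ 2) =
      1 / √(lam γ δ) * (1 / √(2 * Real.pi * (δ ^ 2 / lam γ δ))) := by
    rw [div_mul_div_comm, one_mul, ← Real.sqrt_mul hl.le]
    congr 2
    field_simp
  have henv : (a * rho γ δ) ^ 2 / (2 * (lam γ δ / γ ^ 2 * rho γ δ ^ 2)) =
      a ^ 2 * γ ^ 2 / (2 * lam γ δ) := by
    field_simp
  have hexp : Real.exp (-((y - a) ^ 2 / (2 * δ ^ 2))) * Real.exp (-(γ ^ 2 * (a + y) ^ 2 / 8)) =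
      Real.exp (-((a * rho γ δ) ^ 2 / (2 * (lam γ δ / γ ^ 2 * rho γ δ ^ 2)))) *
        Real.exp (-((y - a * rho γ δ) ^ 2 / (2 * (δ ^ 2 / lam γ δ)))) := by
    rw [← Real.exp_add, ← Real.exp_add, henv, rho]
    congr 1
    unfold lam at hl ⊢
    field_simp
    ring
  rw [gauss, gauss, hscale]
  linear_combination (1 / √(lam γ δ) * (1 / √(2 * Real.pi * (δ ^ 2 / lam γ δ)))) * hexp

theorem hasKetIntegral_displaced_posKet {γ δ : ℝ} (h : 0 < γ * δ) (hρ : rho γ δ ≠ 0) (a : ℝ) :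
    HasKetIntegral (displaced γ δ (posKet a)) (((1 / √(lam γ δ) : ℝ) : ℂ) •
      smearedKet (lam γ δ / γ ^ 2 * rho γ δ ^ 2) (δ ^ 2 / lam γ δ) (a * rho γ δ)) := fun φ => by
  have hδ : 0 < δ ^ 2 := sq_pos_of_ne_zero (right_ne_zero_of_mul h.ne')
  refine ⟨integrable_displaced_posKet h φ a, ?_⟩
  rw [integral_displaced_posKet h, Lp.toTemperedDistribution_apply]
  refine integral_congr_ae ?_
  filter_upwards [smearedKet_ae_eq (lam γ δ / γ ^ 2 * rho γ δ ^ 2)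
      (div_pos hδ (lam_pos γ δ)) (a * rho γ δ),
    Lp.coeFn_smul ((1 / √(lam γ δ) : ℝ) : ℂ)
      (smearedKet (lam γ δ / γ ^ 2 * rho γ δ ^ 2) (δ ^ 2 / lam γ δ) (a * rho γ δ))] with y hy hsmul
  rw [hsmul, Pi.smul_apply, hy, displacement_kernel_eq h hρ, smul_eq_mul, smul_eq_mul,
    ← Complex.ofReal_mul]

theorem IsDiracComb.hasKetIntegral_displaced {c : ℂ} {Γ a γ δ : ℝ} {T : 𝓢'(ℝ, ℂ)}
    (hT : IsDiracComb c Γ a T) (hΓ : Γ ≠ 0) (h : 0 < γ * δ) (hρ : rho γ δ ≠ 0) :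
    HasKetIntegral (displaced γ δ T) ((c * ((1 / √(lam γ δ) : ℝ) : ℂ)) •
      gaussComb (lam γ δ / γ ^ 2 * rho γ δ ^ 2) (δ ^ 2 / lam γ δ) (Γ * rho γ δ) a) := by
  have hγ : γ ≠ 0 := left_ne_zero_of_mul h.ne'
  have hl : 0 < lam γ δ := lam_pos γ δ
  have hΦ := (hasSum_gaussComb (μ := lam γ δ / γ ^ 2 * rho γ δ ^ 2) (by positivity)
    (mul_ne_zero hΓ hρ) (δ ^ 2 / lam γ δ) a).const_smul (c * ((1 / √(lam γ δ) : ℝ) : ℂ))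
  have hu : Summable fun s : ℤ => 1 / (1 + ((s + a) * Γ) ^ 2) :=
    (summable_weight hΓ (a * Γ)).congr fun s => by ring
  refine HasKetIntegral.hasSum (F := fun (s : ℤ) r => c • displaced γ δ (posKet ((s + a) * Γ)) r)
    (fun s => (hasKetIntegral_displaced_posKet h hρ _).const_smul c) ?_ (fun φ r => ?_) hu
    fun φ => ?_
  · simpa only [mul_smul, mul_assoc] using hΦ
  · simpa [displaced_apply h, posKet, mul_left_comm] using
      (hT (opX (-r.2) (opZ r.1 φ))).mul_left (((gauss (γ ^ 2) r.1 * gauss (δ ^ 2) r.2 : ℝ) : ℂ) *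
        Complex.exp (-Complex.I * r.1 * r.2 / 2))
  · obtain ⟨W, hW, hbound⟩ := exists_integrable_bound_displaced h φ
    refine ⟨fun r => ‖c‖ * W r, hW.const_mul _, fun s r => ?_⟩
    rw [mul_left_comm]
    exact (norm_smul_le c _).trans (mul_le_mul_of_nonneg_left (hbound _ r) (norm_nonneg c))

theorem hasKetIntegral_integrand2 {d : ℕ} (hd : 0 < d) (j : ℕ) {γ δ : ℝ} (h : 0 < γ * δ)
    (hρ : rho γ δ ≠ 0) :
    HasKetIntegral (integrand2 d j γ δ) (((√(alphaD d * d / lam γ δ) : ℝ) : ℂ) •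
      gaussComb (lam γ δ / γ ^ 2 * rho γ δ ^ 2) (δ ^ 2 / lam γ δ) (alphaD d * d * rho γ δ)
        (j / d)) := by
  have hα := alphaD_pos hd
  rw [Real.sqrt_div (by positivity), div_eq_mul_one_div (√(alphaD d * d)), Complex.ofReal_mul]
  exact (isDiracComb_ideal hd j).hasKetIntegral_displaced (by positivity) h hρ

/-! ### The Mehler formula -/

section Mehler

open ProbabilityTheory

theorem hermite_mul_exp_eq_integral (n : ℕ) (x : ℝ) :
    ((Polynomial.aeval x (Polynomial.hermite n) * Real.exp (-(x ^ 2 / 2)) : ℝ) : ℂ) =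
      ∫ ξ : ℝ, (-Complex.I * ξ) ^ n * Complex.exp (x * ξ * Complex.I) ∂gaussianReal 0 1 := by
  have hchar : charFun (gaussianReal 0 1) =
      Complex.ofRealCLM ∘ fun t : ℝ => Real.exp (-(t ^ 2 / 2)) := by
    funext t
    rw [charFun_gaussianReal, Function.comp_apply, Complex.ofRealCLM_apply]
    push_cast
    congr 1
    ring
  have hderiv := iteratedDeriv_charFun (μ := gaussianReal 0 1) (n := n) (t := x)
    (memLp_id_gaussianReal n)
  rw [hchar, iteratedDeriv_eq_iteratedFDeriv, ContinuousLinearMap.iteratedFDeriv_comp_left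
    Complex.ofRealCLM (n := n) (ContDiff.contDiffAt (by fun_prop)) le_rfl,
    ContinuousLinearMap.compContinuousMultilinearMap_coe, Function.comp_apply,
    ← iteratedDeriv_eq_iteratedFDeriv, iteratedDeriv_eq_iterate,
    Polynomial.deriv_gaussian_eq_hermite_mul_gaussian, mul_assoc, Complex.ofRealCLM_apply] at hderiv
  simp only [mul_pow, mul_assoc, integral_const_mul] at hderiv ⊢
  rw [neg_pow, mul_assoc, ← hderiv, Complex.ofReal_mul ((-1) ^ n), ← mul_assoc, Complex.ofReal_pow,
    Complex.ofReal_neg, Complex.ofReal_one, ← mul_pow, neg_mul_neg, one_mul, one_pow, one_mul]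

theorem integral_gaussianReal_cexp_quadratic {s : ℝ} (hs : s < 1) (z : ℂ) :
    ∫ ξ : ℝ, Complex.exp (s * ξ ^ 2 / 2 + z * ξ) ∂gaussianReal 0 1 =
      ((1 / √(1 - s) : ℝ) : ℂ) * Complex.exp (z ^ 2 / (2 * (1 - s))) := by
  have hs' : 0 < 1 - s := sub_pos.2 hs
  have hsC : (1 - s : ℂ) ≠ 0 := by exact_mod_cast hs'.ne'
  have hdensity : ∀ ξ : ℝ, gaussianPDFReal 0 1 ξ • Complex.exp (s * ξ ^ 2 / 2 + z * ξ) =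
      ((1 / √(2 * Real.pi) : ℝ) : ℂ) *
        Complex.exp (((-((1 - s) / 2) : ℝ) : ℂ) * ξ ^ 2 + z * ξ + 0) := fun ξ => by
    rw [gaussianPDFReal, Complex.real_smul, Complex.ofReal_mul, mul_assoc, Complex.ofReal_exp,
      ← Complex.exp_add, NNReal.coe_one, mul_one, ← one_div]
    congr 2
    push_cast
    ring
  have hroot : ((Real.pi : ℂ) / -((-((1 - s) / 2) : ℝ) : ℂ)) ^ (1 / 2 : ℂ) =
      ((√(2 * Real.pi / (1 - s)) : ℝ) : ℂ) := by
    rw [Real.sqrt_eq_rpow, Complex.ofReal_cpow (by positivity)]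
    push_cast
    congr 1
    field_simp
  rw [integral_gaussianReal_eq_integral_smul one_ne_zero, integral_congr_ae (ae_of_all _ hdensity),
    integral_const_mul, integral_cexp_quadratic
      (by rw [Complex.ofReal_re]; exact neg_lt_zero.2 (half_pos hs')), hroot, ← mul_assoc,
    ← Complex.ofReal_mul, Real.sqrt_div' _ hs'.le, one_div_mul_eq_div, div_right_comm,
    div_self (by positivity)]
  congr 2
  push_cast
  field_simp
  ring

theorem integrable_exp_mul_sq_gaussianReal {s : ℝ} (hs : s < 1) :
    Integrable (fun ξ : ℝ => Real.exp (s * ξ ^ 2 / 2)) (gaussianReal 0 1) := by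
  have hint := integral_gaussianReal_cexp_quadratic hs 0
  have hne : ((1 / √(1 - s) : ℝ) : ℂ) * Complex.exp (0 ^ 2 / (2 * (1 - s))) ≠ 0 := by
    have := sub_pos.2 hs
    exact mul_ne_zero (by exact_mod_cast (by positivity : (0 : ℝ) < 1 / √(1 - s)).ne')
      (Complex.exp_ne_zero _)
  have hC := (Integrable.of_integral_ne_zero (hint ▸ hne)).re
  refine hC.congr (ae_of_all _ fun ξ => ?_)
  change (Complex.exp (s * ξ ^ 2 / 2 + 0 * ξ)).re = Real.exp (s * ξ ^ 2 / 2)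
  rw [zero_mul, add_zero,
    show (s : ℂ) * ξ ^ 2 / 2 = ((s * ξ ^ 2 / 2 : ℝ) : ℂ) by push_cast; ring, Complex.exp_ofReal_re]

theorem integrable_exp_mul_abs_mul_abs_gaussianReal {r : ℝ} (hr0 : 0 ≤ r) (hr : r < 1) :
    Integrable (fun z : ℝ × ℝ => Real.exp (r * |z.1| * |z.2|))
      ((gaussianReal 0 1).prod (gaussianReal 0 1)) := by
  refine ((integrable_exp_mul_sq_gaussianReal hr).mul_prod
    (integrable_exp_mul_sq_gaussianReal hr)).mono'
    (Continuous.aestronglyMeasurable (by fun_prop)) (ae_of_all _ fun z => ?_)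
  rw [Real.norm_of_nonneg (Real.exp_pos _).le, ← Real.exp_add, Real.exp_le_exp]
  nlinarith [mul_nonneg hr0 (sq_nonneg (|z.1| - |z.2|)), sq_abs z.1, sq_abs z.2]

theorem norm_cexp_mul_mul_I (x ξ : ℝ) : ‖Complex.exp (x * ξ * Complex.I)‖ = 1 := by
  rw [← Complex.ofReal_mul, Complex.norm_exp_ofReal_mul_I]

theorem integral_gaussianReal_cexp_mul (r x y ξ : ℝ) :
    ∫ η : ℝ, Complex.exp (-r * ξ * η) *
        (Complex.exp (x * ξ * Complex.I) * Complex.exp (y * η * Complex.I)) ∂gaussianReal 0 1 =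
      Complex.exp (-(y ^ 2 / 2)) *
        Complex.exp (((r ^ 2 : ℝ) : ℂ) * ξ ^ 2 / 2 + (x - r * y) * Complex.I * ξ) := by
  have hη : ∀ η : ℝ, Complex.exp (-r * ξ * η) *
      (Complex.exp (x * ξ * Complex.I) * Complex.exp (y * η * Complex.I)) =
      Complex.exp (x * ξ * Complex.I) * Complex.exp (((0 : ℝ) : ℂ) * η ^ 2 / 2 +
        (y * Complex.I - r * ξ) * η) := fun η => by
    simp only [← Complex.exp_add]
    congr 1
    push_cast
    ring
  rw [integral_congr_ae (ae_of_all _ hη), integral_const_mul,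
    integral_gaussianReal_cexp_quadratic one_pos, sub_zero, Real.sqrt_one, one_div_one,
    Complex.ofReal_one, one_mul, ← Complex.exp_add, ← Complex.exp_add]
  congr 1
  push_cast
  linear_combination ((y : ℂ) ^ 2 / 2) * Complex.I_sq

theorem integral_gaussianReal_prod_cexp {r : ℝ} (hr : |r| < 1) (x y : ℝ) :
    ∫ z : ℝ × ℝ, Complex.exp (-r * z.1 * z.2) *
        (Complex.exp (x * z.1 * Complex.I) * Complex.exp (y * z.2 * Complex.I))
        ∂(gaussianReal 0 1).prod (gaussianReal 0 1) =
      ((1 / √(1 - r ^ 2) * Real.exp (-((x ^ 2 - 2 * r * x * y + y ^ 2) / (2 * (1 - r ^ 2)))) : ℝ) :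
        ℂ) := by
  have hr2 : r ^ 2 < 1 := (sq_lt_one_iff_abs_lt_one r).2 hr
  have hrC : (1 - (r : ℂ) ^ 2) ≠ 0 := by exact_mod_cast (sub_pos.2 hr2).ne'
  have hint : Integrable (fun z : ℝ × ℝ => Complex.exp (-r * z.1 * z.2) *
      (Complex.exp (x * z.1 * Complex.I) * Complex.exp (y * z.2 * Complex.I)))
      ((gaussianReal 0 1).prod (gaussianReal 0 1)) := by
    refine (integrable_exp_mul_abs_mul_abs_gaussianReal (abs_nonneg r) hr).mono'
      (Continuous.aestronglyMeasurable (by fun_prop)) (ae_of_all _ fun z => ?_)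
    rw [norm_mul, norm_mul, norm_cexp_mul_mul_I, norm_cexp_mul_mul_I, mul_one, mul_one,
      ← abs_mul, ← abs_mul, Complex.norm_exp, Real.exp_le_exp]
    refine le_trans (le_of_eq ?_) (neg_le_abs _)
    rw [← Complex.ofReal_neg, ← Complex.ofReal_mul, ← Complex.ofReal_mul, Complex.ofReal_re]
    ring
  rw [integral_prod _ hint,
    integral_congr_ae (ae_of_all _ fun ξ => integral_gaussianReal_cexp_mul r x y ξ),
    integral_const_mul, integral_gaussianReal_cexp_quadratic hr2, mul_left_comm, ← Complex.exp_add,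
    Complex.ofReal_mul, Complex.ofReal_exp, mul_pow, Complex.I_sq]
  congr 2
  push_cast
  field_simp
  ring

theorem hasSum_integral_gaussianReal_prod_pow {r : ℝ} (hr : |r| < 1) (x y : ℝ) :
    HasSum (fun n : ℕ => ∫ z : ℝ × ℝ, (-r * z.1 * z.2 : ℂ) ^ n / n.factorial *
        (Complex.exp (x * z.1 * Complex.I) * Complex.exp (y * z.2 * Complex.I))
        ∂(gaussianReal 0 1).prod (gaussianReal 0 1))
      (∫ z : ℝ × ℝ, Complex.exp (-r * z.1 * z.2) *
        (Complex.exp (x * z.1 * Complex.I) * Complex.exp (y * z.2 * Complex.I))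
        ∂(gaussianReal 0 1).prod (gaussianReal 0 1)) := by
  have hexp : ∀ z : ℝ × ℝ, HasSum (fun n : ℕ => (|r| * |z.1| * |z.2|) ^ n / n.factorial)
      (Real.exp (|r| * |z.1| * |z.2|)) := fun z => by
    rw [Real.exp_eq_exp_ℝ]
    exact NormedSpace.expSeries_div_hasSum_exp _
  have hcexp : ∀ z : ℝ × ℝ, HasSum (fun n : ℕ => (-r * z.1 * z.2 : ℂ) ^ n / n.factorial *
      (Complex.exp (x * z.1 * Complex.I) * Complex.exp (y * z.2 * Complex.I)))
      (Complex.exp (-r * z.1 * z.2) *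
        (Complex.exp (x * z.1 * Complex.I) * Complex.exp (y * z.2 * Complex.I))) := fun z => by
    refine HasSum.mul_right _ ?_
    rw [Complex.exp_eq_exp_ℂ]
    exact NormedSpace.expSeries_div_hasSum_exp _
  have hnorm : ∀ (n : ℕ) (z : ℝ × ℝ), ‖(-r * z.1 * z.2 : ℂ) ^ n / n.factorial *
      (Complex.exp (x * z.1 * Complex.I) * Complex.exp (y * z.2 * Complex.I))‖ =
      (|r| * |z.1| * |z.2|) ^ n / n.factorial := fun n z => by
    rw [norm_mul, norm_mul, norm_cexp_mul_mul_I, norm_cexp_mul_mul_I, mul_one, mul_one, norm_div,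
      norm_pow, norm_mul, norm_mul, norm_neg, Complex.norm_real, Complex.norm_real,
      Complex.norm_real, Complex.norm_natCast, Real.norm_eq_abs, Real.norm_eq_abs, Real.norm_eq_abs]
  exact hasSum_integral_of_dominated_convergence
    (μ := (gaussianReal 0 1).prod (gaussianReal 0 1)) _
    (fun n => Continuous.aestronglyMeasurable (by fun_prop))
    (fun n => ae_of_all _ fun z => (hnorm n z).le) (ae_of_all _ fun z => (hexp z).summable)
    (by simpa only [fun z => (hexp z).tsum_eq] using
      integrable_exp_mul_abs_mul_abs_gaussianReal (abs_nonneg r) hr)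
    (ae_of_all _ hcexp)

/-- Each `Heₙ(x) exp(-x²/2)` is a Fourier integral against the standard Gaussian, which turns the
series into an exponential series under a double Gaussian integral. -/
theorem hasSum_hermite_mul_hermite {r : ℝ} (hr : |r| < 1) (x y : ℝ) :
    HasSum (fun n : ℕ => r ^ n / n.factorial *
        ((Polynomial.aeval x (Polynomial.hermite n) * Real.exp (-(x ^ 2 / 2))) *
          (Polynomial.aeval y (Polynomial.hermite n) * Real.exp (-(y ^ 2 / 2)))))
      (1 / √(1 - r ^ 2) * Real.exp (-((x ^ 2 - 2 * r * x * y + y ^ 2) / (2 * (1 - r ^ 2))))) := by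
  have hsum := hasSum_integral_gaussianReal_prod_pow hr x y
  rw [integral_gaussianReal_prod_cexp hr] at hsum
  rw [← Complex.hasSum_ofReal]
  refine (congrArg (HasSum · _) (funext fun n => ?_)).mpr hsum
  rw [Complex.ofReal_mul, Complex.ofReal_mul (_ * _), hermite_mul_exp_eq_integral,
    hermite_mul_exp_eq_integral, ← integral_prod_mul, ← integral_const_mul]
  refine integral_congr_ae (ae_of_all _ fun z => ?_)
  have hpow : (-r * z.1 * z.2 : ℂ) ^ n =
      r ^ n * ((-Complex.I * z.1) ^ n * (-Complex.I * z.2) ^ n) := by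
    rw [← mul_pow, ← mul_pow]
    congr 1
    linear_combination (-(r : ℂ) * z.1 * z.2) * Complex.I_sq
  simp only [hpow]
  push_cast
  ring

end Mehler

/-! ### Hermite functions and the Mehler kernel -/

/-- The `n`-th Hermite function, the position wave function of the Fock state `|n⟩`. The library's
`Polynomial.hermite` is the probabilists' polynomial, orthogonal for `exp(-x²/2)`, whence the
argument `√2 * x`. -/
noncomputable def hermiteFunction (n : ℕ) (x : ℝ) : ℝ :=
  1 / √(n.factorial : ℝ) * (Real.pi ^ (-(1 / 4 : ℝ)) *
    (Polynomial.aeval (√2 * x) (Polynomial.hermite n) * Real.exp (-(x ^ 2 / 2))))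

theorem creation_pow_vacuum_apply (n : ℕ) (x : ℝ) :
    (creation ^ n) vacuum x = ((Real.pi ^ (-(1 / 4 : ℝ)) *
      (Polynomial.aeval (√2 * x) (Polynomial.hermite n) * Real.exp (-(x ^ 2 / 2))) : ℝ) : ℂ) := by
  induction n generalizing x with
  | zero =>
    rw [Polynomial.hermite_zero, Polynomial.aeval_C, map_one, one_mul]
    exact vacuum_apply x
  | succ n ih =>
    have hpoly : HasDerivAt (fun y : ℝ => Polynomial.aeval (√2 * y) (Polynomial.hermite n))
        (Polynomial.aeval (√2 * x) (Polynomial.derivative (Polynomial.hermite n)) * √2) x :=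
      ((Polynomial.hermite n).hasDerivAt_aeval (√2 * x)).comp x
        (hasDerivAt_const_mul √2)
    have hexp : HasDerivAt (fun y : ℝ => Real.exp (-(y ^ 2 / 2)))
        (Real.exp (-(x ^ 2 / 2)) * -x) x :=
      (((hasDerivAt_pow 2 x).div_const 2).fun_neg.congr_deriv (by norm_num)).exp
    have hwave := ((hpoly.fun_mul hexp).const_mul (Real.pi ^ (-(1 / 4 : ℝ)))).ofReal_comp
    rw [pow_succ', mul_apply_eq_comp, creation_apply, ih,
      funext (f := ((creation ^ n) vacuum : ℝ → ℂ)) ih, hwave.deriv, Polynomial.hermite_succ,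
      map_sub, map_mul, Polynomial.aeval_X, ← Complex.ofReal_mul, ← Complex.ofReal_sub,
      ← Complex.ofReal_mul, Complex.ofReal_inj]
    field_simp
    linear_combination (-x * Polynomial.aeval (√2 * x) (Polynomial.hermite n)) *
      Real.sq_sqrt zero_le_two

theorem fock_apply (n : ℕ) (x : ℝ) : fock n x = ((hermiteFunction n x : ℝ) : ℂ) := by
  rw [fock, smul_apply, creation_pow_vacuum_apply, smul_eq_mul, ← Complex.ofReal_mul,
    hermiteFunction]

theorem conjS_fock (n : ℕ) : conjS (fock n) = fock n := by
  ext x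
  change (starRingEnd ℂ) (fock n x) = fock n x
  rw [fock_apply, Complex.conj_ofReal]

/-- The Mehler kernel, the position representation of `exp(-β (n̂ + 1/2))`. -/
noncomputable def mehlerKernel (β x y : ℝ) : ℝ :=
  1 / √(2 * Real.pi * Real.sinh β) *
    Real.exp (-(Real.cosh β * (x ^ 2 + y ^ 2) - 2 * x * y) / (2 * Real.sinh β))

theorem mehlerKernel_eq_gauss {β : ℝ} (hβ : 0 < β) (x y : ℝ) :
    mehlerKernel β x y = 1 / √(Real.cosh β) *
      (Real.exp (-((x / Real.cosh β) ^ 2 / (2 * (1 / (Real.sinh β * Real.cosh β))))) *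
        gauss (Real.tanh β) (y - x / Real.cosh β)) := by
  have hcosh : 0 < Real.cosh β := Real.cosh_pos β
  have hscale : √(2 * Real.pi * Real.sinh β) =
      √(Real.cosh β) * √(2 * Real.pi * Real.tanh β) := by
    rw [← Real.sqrt_mul hcosh.le, Real.tanh_eq_sinh_div_cosh]
    congr 1
    field_simp
  have hexp : Real.exp (-(Real.cosh β * (x ^ 2 + y ^ 2) - 2 * x * y) / (2 * Real.sinh β)) =
      Real.exp (-((x / Real.cosh β) ^ 2 / (2 * (1 / (Real.sinh β * Real.cosh β))))) *
        Real.exp (-((y - x / Real.cosh β) ^ 2 / (2 * Real.tanh β))) := by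
    rw [← Real.exp_add, Real.tanh_eq_sinh_div_cosh]
    congr 1
    field_simp
    linear_combination (-(x ^ 2)) * Real.cosh_sq β
  rw [mehlerKernel, gauss, hscale, hexp, one_div_mul_eq_div, div_mul_eq_div_div]
  ring

theorem hermiteFunction_eq (n : ℕ) (x : ℝ) : hermiteFunction n x =
    1 / √(n.factorial : ℝ) * (Real.pi ^ (-(1 / 4 : ℝ)) * Real.exp (x ^ 2 / 2)) *
      (Polynomial.aeval (√2 * x) (Polynomial.hermite n) * Real.exp (-((√2 * x) ^ 2 / 2))) := by
  have hexp : Real.exp (-(x ^ 2 / 2)) =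
      Real.exp (x ^ 2 / 2) * Real.exp (-((√2 * x) ^ 2 / 2)) := by
    rw [← Real.exp_add, mul_pow, Real.sq_sqrt zero_le_two]
    congr 1
    ring
  rw [hermiteFunction, hexp]
  ring

theorem one_sub_exp_neg_sq (β : ℝ) :
    1 - Real.exp (-β) ^ 2 = 2 * Real.exp (-β) * Real.sinh β := by
  rw [Real.sinh_eq, Real.exp_neg]
  field_simp

theorem one_add_exp_neg_sq (β : ℝ) :
    1 + Real.exp (-β) ^ 2 = 2 * Real.exp (-β) * Real.cosh β := by
  rw [Real.cosh_eq, Real.exp_neg]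
  field_simp

theorem mehlerKernel_eq {β : ℝ} (hβ : 0 < β) (x y : ℝ) : mehlerKernel β x y =
    Real.exp (-β / 2) * (Real.pi ^ (-(1 / 4 : ℝ)) * Real.exp (x ^ 2 / 2)) *
      (Real.pi ^ (-(1 / 4 : ℝ)) * Real.exp (y ^ 2 / 2)) * (1 / √(1 - Real.exp (-β) ^ 2) *
        Real.exp (-(((√2 * x) ^ 2 - 2 * Real.exp (-β) * (√2 * x) * (√2 * y) + (√2 * y) ^ 2) /
          (2 * (1 - Real.exp (-β) ^ 2))))) := by
  have hpi : Real.pi ^ (-(1 / 4 : ℝ)) * Real.pi ^ (-(1 / 4 : ℝ)) = 1 / √Real.pi := by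
    rw [← Real.rpow_add Real.pi_pos, Real.sqrt_eq_rpow, ← neg_add, Real.rpow_neg Real.pi_pos.le,
      inv_eq_one_div]
    norm_num
  have hprefactor : Real.exp (-β / 2) * (1 / √Real.pi) * (1 / √(1 - Real.exp (-β) ^ 2)) =
      1 / √(2 * Real.pi * Real.sinh β) := by
    rw [Real.exp_half, one_sub_exp_neg_sq,
      show 2 * Real.exp (-β) * Real.sinh β = Real.exp (-β) * (2 * Real.sinh β) by ring,
      show 2 * Real.pi * Real.sinh β = Real.pi * (2 * Real.sinh β) by ring,
      Real.sqrt_mul (Real.exp_pos _).le, Real.sqrt_mul Real.pi_pos.le]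
    field_simp
  have hexp : Real.exp (x ^ 2 / 2) * Real.exp (y ^ 2 / 2) *
      Real.exp (-(((√2 * x) ^ 2 - 2 * Real.exp (-β) * (√2 * x) * (√2 * y) + (√2 * y) ^ 2) /
        (2 * (1 - Real.exp (-β) ^ 2)))) =
      Real.exp (-(Real.cosh β * (x ^ 2 + y ^ 2) - 2 * x * y) / (2 * Real.sinh β)) := by
    rw [← Real.exp_add, ← Real.exp_add,
      show (√2 * x) ^ 2 - 2 * Real.exp (-β) * (√2 * x) * (√2 * y) + (√2 * y) ^ 2 =
        2 * (x ^ 2 - 2 * Real.exp (-β) * x * y + y ^ 2) by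
          linear_combination
            (x ^ 2 - 2 * Real.exp (-β) * x * y + y ^ 2) * Real.sq_sqrt zero_le_two,
      one_sub_exp_neg_sq]
    congr 1
    field_simp
    linear_combination (-(x ^ 2 + y ^ 2) / 2) *
      (one_add_exp_neg_sq β + one_sub_exp_neg_sq β)
  rw [mehlerKernel, ← hprefactor, ← hexp, ← hpi]
  ring

theorem hasSum_hermiteFunction_mul {β : ℝ} (hβ : 0 < β) (x y : ℝ) :
    HasSum (fun n : ℕ => Real.exp (-β * (n + 1 / 2)) * (hermiteFunction n x * hermiteFunction n y))
      (mehlerKernel β x y) := by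
  have hr : |Real.exp (-β)| < 1 := by
    rw [Real.abs_exp]
    exact Real.exp_lt_one_iff.2 (neg_lt_zero.2 hβ)
  rw [mehlerKernel_eq hβ]
  refine ((hasSum_hermite_mul_hermite hr (√2 * x) (√2 * y)).mul_left _).congr_fun fun n => ?_
  have hweight : Real.exp (-β * (n + 1 / 2)) = Real.exp (-β / 2) * Real.exp (-β) ^ n := by
    rw [← Real.exp_nat_mul, ← Real.exp_add]
    congr 1
    ring
  have hfac : 1 / √(n.factorial : ℝ) * (1 / √(n.factorial : ℝ)) = 1 / n.factorial := by
    rw [div_mul_div_comm, one_mul, Real.mul_self_sqrt (by positivity)]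
  rw [hermiteFunction_eq, hermiteFunction_eq, hweight, div_eq_mul_one_div (Real.exp (-β) ^ n),
    ← hfac]
  ring

/-! ### Approximation 3 -/

theorem abs_hermiteFunction_le {ε : ℝ} (hε : 0 < ε) (n : ℕ) (x : ℝ) :
    |hermiteFunction n x| ≤ Real.exp (ε * (n + 1 / 2)) * √(mehlerKernel (2 * ε) x x) := by
  have hsum := hasSum_hermiteFunction_mul (mul_pos two_pos hε) x x
  have hterm : Real.exp (-(2 * ε) * (n + 1 / 2)) * (hermiteFunction n x * hermiteFunction n x) ≤
      mehlerKernel (2 * ε) x x :=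
    le_hasSum hsum n fun m _ => mul_nonneg (Real.exp_pos _).le (mul_self_nonneg _)
  have hexp : Real.exp (ε * (n + 1 / 2)) ^ 2 * Real.exp (-(2 * ε) * (n + 1 / 2)) = 1 := by
    rw [← Real.exp_nat_mul, ← Real.exp_add, Real.exp_eq_one_iff]
    push_cast
    ring
  rw [← Real.sqrt_sq (Real.exp_pos (ε * (n + 1 / 2))).le, ← Real.sqrt_mul (sq_nonneg _)]
  refine Real.abs_le_sqrt ?_
  calc hermiteFunction n x ^ 2
      = Real.exp (ε * (n + 1 / 2)) ^ 2 * (Real.exp (-(2 * ε) * (n + 1 / 2)) *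
          (hermiteFunction n x * hermiteFunction n x)) := by rw [← mul_assoc, hexp, one_mul, sq]
    _ ≤ _ := mul_le_mul_of_nonneg_left hterm (sq_nonneg _)

theorem mehlerKernel_self {β : ℝ} (hβ : 0 < β) (x : ℝ) : mehlerKernel β x x =
    1 / √(2 * Real.pi * Real.sinh β) *
      Real.exp (-(x ^ 2 / (2 * (Real.sinh β / (Real.cosh β - 1))))) ^ 2 := by
  have hsinh : Real.sinh β ≠ 0 := (Real.sinh_pos_iff.2 hβ).ne'
  have : Real.cosh β - 1 ≠ 0 := (sub_pos.2 (Real.one_lt_cosh.2 hβ.ne')).ne'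
  rw [mehlerKernel, ← Real.exp_nat_mul]
  congr 2
  push_cast
  field_simp
  ring

theorem exists_abs_hermiteFunction_le_gauss {ε : ℝ} (hε : 0 < ε) : ∃ C ν : ℝ, 0 ≤ C ∧ 0 < ν ∧
    ∀ (n : ℕ) (x : ℝ), |hermiteFunction n x| ≤ C * Real.exp (ε * n) * gauss ν x := by
  have hsinh : 0 < Real.sinh (2 * ε) := Real.sinh_pos_iff.2 (mul_pos two_pos hε)
  have hcosh : 0 < Real.cosh (2 * ε) - 1 :=
    sub_pos.2 (Real.one_lt_cosh.2 (mul_pos two_pos hε).ne')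
  set A := 1 / √(2 * Real.pi * Real.sinh (2 * ε))
  set ν := Real.sinh (2 * ε) / (Real.cosh (2 * ε) - 1) with hν
  have hA : 0 ≤ A := by positivity
  have hν_pos : 0 < ν := div_pos hsinh hcosh
  refine ⟨Real.exp (ε / 2) * √A * √(2 * Real.pi * ν), ν, by positivity, hν_pos, fun n x => ?_⟩
  refine (abs_hermiteFunction_le hε n x).trans_eq ?_
  rw [mehlerKernel_self (mul_pos two_pos hε), ← hν, Real.sqrt_mul hA,
    Real.sqrt_sq (Real.exp_pos _).le, gauss,
    show ε * (n + 1 / 2) = ε / 2 + ε * n by ring, Real.exp_add]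
  field_simp

theorem norm_toLp_fock_le {C ν : ℝ} (hν : 0 < ν) (n : ℕ)
    (h : ∀ x, |hermiteFunction n x| ≤ C * gauss ν x) :
    ‖(fock n).toLp 2 volume‖ ≤ C * ‖gaussKet ν 0‖ := by
  refine Lp.norm_le_mul_norm_of_ae_le_mul ?_
  filter_upwards [SchwartzMap.coeFn_toLp (fock n) 2 volume, gaussKet_ae_eq hν 0]
    with x hfock hgauss
  rw [hfock, hgauss, fock_apply, Complex.norm_real, Complex.norm_real, sub_zero,
    Real.norm_of_nonneg (gauss_pos hν x).le]
  exact h x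

/-- The `n`-th term of the Fock expansion of the damped position ket `exp(-β (n̂ + 1/2)) |x⟩`. -/
noncomputable def dampedPosKetTerm (β x : ℝ) (n : ℕ) : L2 :=
  ((Real.exp (-β * (n + 1 / 2)) * hermiteFunction n x : ℝ) : ℂ) • (fock n).toLp 2 volume

theorem exists_norm_dampedPosKetTerm_le {β : ℝ} (hβ : 0 < β) : ∃ C ν : ℝ, 0 < ν ∧
    ∀ x n, ‖dampedPosKetTerm β x n‖ ≤ C * (Real.exp (n * -(β / 2)) * gauss ν x) := by
  obtain ⟨C, ν, hC, hν, hbound⟩ :=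
    exists_abs_hermiteFunction_le_gauss (show 0 < β / 4 by positivity)
  refine ⟨Real.exp (-β / 2) * C ^ 2 * ‖gaussKet ν 0‖, ν, hν, fun x n => ?_⟩
  have hexp : Real.exp (-β * (n + 1 / 2)) * Real.exp (β / 4 * n) * Real.exp (β / 4 * n) =
      Real.exp (-β / 2) * Real.exp (n * -(β / 2)) := by
    rw [← Real.exp_add, ← Real.exp_add, ← Real.exp_add]
    congr 1
    ring
  have hgauss := (gauss_pos hν x).le
  rw [dampedPosKetTerm, norm_smul, Complex.norm_real, norm_mul, Real.norm_eq_abs,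
    Real.norm_eq_abs, Real.abs_exp]
  calc Real.exp (-β * (n + 1 / 2)) * |hermiteFunction n x| * ‖(fock n).toLp 2 volume‖
      ≤ Real.exp (-β * (n + 1 / 2)) * (C * Real.exp (β / 4 * n) * gauss ν x) *
          (C * Real.exp (β / 4 * n) * ‖gaussKet ν 0‖) := by
        gcongr
        · exact hbound n x
        · exact norm_toLp_fock_le hν n (hbound n)
    _ = Real.exp (-β * (n + 1 / 2)) * Real.exp (β / 4 * n) * Real.exp (β / 4 * n) *
          (C ^ 2 * ‖gaussKet ν 0‖ * gauss ν x) := by ring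
    _ = _ := by rw [hexp]; ring

theorem summable_exp_nat_mul_neg {b : ℝ} (hb : 0 < b) :
    Summable fun n : ℕ => Real.exp (n * -b) :=
  Real.summable_exp_nat_mul_iff.2 (neg_lt_zero.2 hb)

theorem tanh_pos {β : ℝ} (hβ : 0 < β) : 0 < Real.tanh β := by
  rw [Real.tanh_eq_sinh_div_cosh]
  exact div_pos (Real.sinh_pos_iff.2 hβ) (Real.cosh_pos β)

theorem hasSum_dampedPosKetTerm {β : ℝ} (hβ : 0 < β) (x : ℝ) :
    HasSum (dampedPosKetTerm β x) (((1 / √(Real.cosh β) : ℝ) : ℂ) •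
      smearedKet (1 / (Real.sinh β * Real.cosh β)) (Real.tanh β) (x / Real.cosh β)) := by
  obtain ⟨C, ν, -, hbound⟩ := exists_norm_dampedPosKetTerm_le hβ
  have hsummable : Summable (dampedPosKetTerm β x) := .of_norm_bounded
    (((summable_exp_nat_mul_neg (half_pos hβ)).mul_right (gauss ν x)).mul_left C) (hbound x)
  have hterm : ∀ n, dampedPosKetTerm β x n =ᵐ[volume] fun q =>
      ((Real.exp (-β * (n + 1 / 2)) * (hermiteFunction n x * hermiteFunction n q) : ℝ) : ℂ) := by
    intro n
    filter_upwards [SchwartzMap.coeFn_toLp (fock n) 2 volume,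
      Lp.coeFn_smul ((Real.exp (-β * (n + 1 / 2)) * hermiteFunction n x : ℝ) : ℂ)
        ((fock n).toLp 2 volume)] with q hq hsmul
    rw [dampedPosKetTerm, hsmul, Pi.smul_apply, hq, fock_apply, smul_eq_mul, ← Complex.ofReal_mul,
      mul_assoc]
  have htsum := ae_eq_of_hasSum hsummable.hasSum hterm
    fun q => Complex.hasSum_ofReal.2 (hasSum_hermiteFunction_mul hβ x q)
  convert hsummable.hasSum using 1
  refine Lp.ext ?_
  filter_upwards [htsum, smearedKet_ae_eq (1 / (Real.sinh β * Real.cosh β)) (tanh_pos hβ)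
      (x / Real.cosh β), Lp.coeFn_smul ((1 / √(Real.cosh β) : ℝ) : ℂ)
      (smearedKet (1 / (Real.sinh β * Real.cosh β)) (Real.tanh β) (x / Real.cosh β))]
    with q hq hsmeared hsmul
  rw [hq, hsmul, Pi.smul_apply, hsmeared, mehlerKernel_eq_gauss hβ, smul_eq_mul,
    ← Complex.ofReal_mul]

theorem IsDiracComb.hasSum_bracket_fock {c : ℂ} {Γ a : ℝ} {T : 𝓢'(ℝ, ℂ)}
    (hT : IsDiracComb c Γ a T) (n : ℕ) :
    HasSum (fun s : ℤ => c * (hermiteFunction n ((s + a) * Γ) : ℂ)) (bracket (fock n) T) := by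
  rw [bracket, conjS_fock]
  exact (hT (fock n)).congr_fun fun s => by rw [fock_apply]

/-- The Fock expansion and the lattice sum are interchanged: the double series converges
absolutely because `dampedPosKetTerm` decays geometrically in `n` and like a Gaussian in `x`. -/
theorem IsDiracComb.hasSum_damped {c : ℂ} {Γ a : ℝ} {T : 𝓢'(ℝ, ℂ)} (hT : IsDiracComb c Γ a T)
    (hΓ : Γ ≠ 0) {β : ℝ} (hβ : 0 < β) :
    HasSum (fun n : ℕ => (((Real.exp (-β * (n + 1 / 2)) : ℝ) : ℂ) * bracket (fock n) T) •
        (fock n).toLp 2 volume)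
      ((c * ((1 / √(Real.cosh β) : ℝ) : ℂ)) • gaussComb (1 / (Real.sinh β * Real.cosh β))
        (Real.tanh β) (Γ / Real.cosh β) a) := by
  have hcosh : 0 < Real.cosh β := Real.cosh_pos β
  obtain ⟨C, ν, hν, hbound⟩ := exists_norm_dampedPosKetTerm_le hβ
  have hsummable : Summable fun p : ℕ × ℤ => c • dampedPosKetTerm β ((p.2 + a) * Γ) p.1 :=
    Summable.const_smul _ (.of_norm_bounded
      (((summable_exp_nat_mul_neg (half_pos hβ)).mul_of_nonneg
        ((summable_exp_comb hν hΓ a).mul_left (1 / √(2 * Real.pi * ν)))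
        (fun _ => (Real.exp_pos _).le) fun _ => (gauss_pos hν _).le).mul_left C)
      fun p => hbound ((p.2 + a) * Γ) p.1)
  have hfock := hsummable.hasSum.prod_fiberwise fun n =>
    (((hT.hasSum_bracket_fock n).mul_left ((Real.exp (-β * (n + 1 / 2)) : ℝ) : ℂ)).smul_const
      ((fock n).toLp 2 volume)).congr_fun fun s => by
        rw [dampedPosKetTerm, smul_smul, Complex.ofReal_mul]
        congr 1
        ring
  have hlattice := ((Equiv.prodComm ℤ ℕ).hasSum_iff.2 hsummable.hasSum).prod_fiberwise fun s =>
    (hasSum_dampedPosKetTerm hβ ((s + a) * Γ)).const_smul c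
  have hcomb := (hasSum_gaussComb (μ := 1 / (Real.sinh β * Real.cosh β)) (Γ := Γ / Real.cosh β)
    (by positivity) (div_ne_zero hΓ hcosh.ne') (Real.tanh β) a).const_smul
      (c * ((1 / √(Real.cosh β) : ℝ) : ℂ))
  rw [hlattice.unique (hcomb.congr_fun fun s => by rw [smul_smul, mul_div_assoc])] at hfock
  exact hfock

theorem hasSum_term3 {d : ℕ} (hd : 0 < d) (j : ℕ) {β : ℝ} (hβ : 0 < β) :
    HasSum (term3 d j β) (((√(alphaD d * d / Real.cosh β) : ℝ) : ℂ) •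
      gaussComb (1 / (Real.sinh β * Real.cosh β)) (Real.tanh β) (alphaD d * d / Real.cosh β)
        (j / d)) := by
  have hα := alphaD_pos hd
  have hΓ : 0 < alphaD d * d := by positivity
  rw [Real.sqrt_div hΓ.le, div_eq_mul_one_div √(alphaD d * d), Complex.ofReal_mul]
  exact (isDiracComb_ideal hd j).hasSum_damped hΓ.ne' hβ

/-! ### The theta functions of the three combs -/

section Theta

variable {d : ℕ} (hd : 0 < d) (j : ℕ) {N : ℝ} (hN : 0 < N) (q : ℝ)
include hd hN

theorem sqrt_mul_conv_eq_theta_displaced {κ Δ : ℝ} (hκ : κ ≠ 0) (hΔ : 0 < Δ) :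
    ((√(2 * √(Real.pi * Δ ^ 2) / N) *
        conv (combE (1 / κ ^ 2) (alphaD d * d) (j / d)) (gauss (Δ ^ 2)) q : ℝ) : ℂ) =
      ((√(2 * √(Real.pi * Δ ^ 2) / (κ ^ 2 * d * N)) *
          gauss ((1 + κ ^ 2 * Δ ^ 2) / κ ^ 2) q : ℝ) : ℂ) *
        theta 0 (j / d) ((-(q / (alphaD d * d * (1 + κ ^ 2 * Δ ^ 2))) : ℝ) : ℂ)
          (Complex.I * ((Δ ^ 2 / (d * (1 + κ ^ 2 * Δ ^ 2)) : ℝ) : ℂ)) := by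
  have hα := alphaD_pos hd
  refine sqrt_mul_conv_eq_theta (by positivity) (by positivity) (by positivity) (by positivity)
    _ q (by field_simp) ?_ (by field_simp) ?_
  · rw [← alphaD_sq_mul hd]
    field_simp
  · rw [← alphaD_sq_mul hd]
    field_simp

theorem sqrt_mul_conv_eq_theta_smeared {γ δ : ℝ} (hpos : 0 < γ * δ) (hne : γ * δ ≠ 2) :
    ((√(alphaD d * d / (lam γ δ * N)) *
        conv (combE (lam γ δ / γ ^ 2 * rho γ δ ^ 2) (alphaD d * d * rho γ δ) (j / d))
          (gauss (δ ^ 2 / lam γ δ)) q : ℝ) : ℂ) =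
      ((√(alphaD d * (γ ^ 2)⁻¹ / N) * gauss (lam γ δ / γ ^ 2) q : ℝ) : ℂ) *
        theta 0 (j / d) ((-(q / (alphaD d * d) * rho γ δ) : ℝ) : ℂ)
          (Complex.I * ((δ ^ 2 / (d * lam γ δ) : ℝ) : ℂ)) := by
  have hα := alphaD_pos hd
  have hγ := left_ne_zero_of_mul hpos.ne'
  have hδ := right_ne_zero_of_mul hpos.ne'
  have hlam := lam_pos γ δ
  have hρ := rho_ne_zero hpos hne
  refine sqrt_mul_conv_eq_theta (by positivity) (by positivity) (by positivity) (by positivity)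
    _ q ?_ ?_ (by field_simp) ?_
  · rw [rho]
    unfold lam at hlam ⊢
    field_simp
    ring
  · rw [← alphaD_sq_mul hd]
    field_simp
  · rw [← alphaD_sq_mul hd]
    field_simp

theorem sqrt_mul_conv_eq_theta_damped {β : ℝ} (hβ : 0 < β) :
    ((√(alphaD d * d / (Real.cosh β * N)) *
        conv (combE (1 / (Real.sinh β * Real.cosh β)) (alphaD d * d / Real.cosh β) (j / d))
          (gauss (Real.tanh β)) q : ℝ) : ℂ) =
      ((√(alphaD d / (Real.sinh β * N)) * gauss (1 / Real.tanh β) q : ℝ) : ℂ) *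
        theta 0 (j / d) ((-(q / (alphaD d * d * Real.cosh β)) : ℝ) : ℂ)
          (Complex.I * ((Real.tanh β / d : ℝ) : ℂ)) := by
  have hα := alphaD_pos hd
  refine sqrt_mul_conv_eq_theta (by positivity) (tanh_pos hβ) (by positivity) (by positivity)
    _ q ?_ ?_ ?_ ?_
  · rw [Real.tanh_eq_sinh_div_cosh]
    field_simp
    linear_combination -Real.cosh_sq β
  · rw [← alphaD_sq_mul hd]
    field_simp
  · rw [Real.tanh_eq_sinh_div_cosh]
    field_simp
  · rw [← alphaD_sq_mul hd, Real.tanh_eq_sinh_div_cosh]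
    field_simp

end Theta

end GKP

open GKP in
theorem proposition1_general (d j : ℕ) (hd : 0 < d) :
    (∀ κ Δ : ℝ, κ ≠ 0 → 0 < Δ →
      Summable (term1 d j κ Δ) ∧ 0 < N1 d j κ Δ ∧ ‖ket1 d j κ Δ‖ = 1 ∧
      (∀ᵐ q : ℝ, ket1 d j κ Δ q =
        ((√(2 * √(Real.pi * Δ ^ 2) / N1 d j κ Δ) *
          conv (combE (1 / κ ^ 2) (alphaD d * d) (j / d)) (gauss (Δ ^ 2)) q : ℝ) : ℂ)) ∧
      (∀ q : ℝ,
        ((√(2 * √(Real.pi * Δ ^ 2) / N1 d j κ Δ) *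
          conv (combE (1 / κ ^ 2) (alphaD d * d) (j / d)) (gauss (Δ ^ 2)) q : ℝ) : ℂ) =
        ((√(2 * √(Real.pi * Δ ^ 2) / (κ ^ 2 * d * N1 d j κ Δ)) *
          gauss ((1 + κ ^ 2 * Δ ^ 2) / κ ^ 2) q : ℝ) : ℂ) *
          theta 0 (j / d) ((-(q / (alphaD d * d * (1 + κ ^ 2 * Δ ^ 2))) : ℝ) : ℂ)
            (Complex.I * ((Δ ^ 2 / (d * (1 + κ ^ 2 * Δ ^ 2)) : ℝ) : ℂ)))) ∧
    (∀ γ δ : ℝ, 0 < γ * δ → γ * δ ≠ 2 →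
      HasKetIntegral (integrand2 d j γ δ) (unnormalized2 d j γ δ) ∧
      0 < N2 d j γ δ ∧ ‖ket2 d j γ δ‖ = 1 ∧
      (∀ᵐ q : ℝ, ket2 d j γ δ q =
        ((√(alphaD d * d / (lam γ δ * N2 d j γ δ)) *
          conv (combE (lam γ δ / γ ^ 2 * rho γ δ ^ 2) (alphaD d * d * rho γ δ) (j / d))
            (gauss (δ ^ 2 / lam γ δ)) q : ℝ) : ℂ)) ∧
      (∀ q : ℝ,
        ((√(alphaD d * d / (lam γ δ * N2 d j γ δ)) *
          conv (combE (lam γ δ / γ ^ 2 * rho γ δ ^ 2) (alphaD d * d * rho γ δ) (j / d))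
            (gauss (δ ^ 2 / lam γ δ)) q : ℝ) : ℂ) =
        ((√(alphaD d * (γ ^ 2)⁻¹ / N2 d j γ δ) * gauss (lam γ δ / γ ^ 2) q : ℝ) : ℂ) *
          theta 0 (j / d) ((-(q / (alphaD d * d) * rho γ δ) : ℝ) : ℂ)
            (Complex.I * ((δ ^ 2 / (d * lam γ δ) : ℝ) : ℂ)))) ∧
    (∀ β : ℝ, 0 < β →
      Summable (term3 d j β) ∧ 0 < N3 d j β ∧ ‖ket3 d j β‖ = 1 ∧
      (∀ᵐ q : ℝ, ket3 d j β q =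
        ((√(alphaD d * d / (Real.cosh β * N3 d j β)) *
          conv (combE (1 / (Real.sinh β * Real.cosh β)) (alphaD d * d / Real.cosh β) (j / d))
            (gauss (Real.tanh β)) q : ℝ) : ℂ)) ∧
      (∀ q : ℝ,
        ((√(alphaD d * d / (Real.cosh β * N3 d j β)) *
          conv (combE (1 / (Real.sinh β * Real.cosh β)) (alphaD d * d / Real.cosh β) (j / d))
            (gauss (Real.tanh β)) q : ℝ) : ℂ) =
        ((√(alphaD d / (Real.sinh β * N3 d j β)) * gauss (1 / Real.tanh β) q : ℝ) : ℂ) *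
          theta 0 (j / d) ((-(q / (alphaD d * d * Real.cosh β)) : ℝ) : ℂ)
            (Complex.I * ((Real.tanh β / d : ℝ) : ℂ)))) := by
  have hα := alphaD_pos hd
  refine ⟨fun κ Δ hκ hΔ => ?_, fun γ δ hpos hne => ?_, fun β hβ => ?_⟩
  · have hsum := hasSum_term1 hd j hκ hΔ
    obtain ⟨hN, hnorm, hket⟩ := normalize_gaussComb (by positivity) (by positivity)
      (by positivity) (by positivity) hsum.tsum_eq
    exact ⟨hsum.summable, hN, hnorm, hket,
      fun q => sqrt_mul_conv_eq_theta_displaced hd j hN q hκ hΔ⟩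
  · have hlam := lam_pos γ δ
    have hρ := rho_ne_zero hpos hne
    have hγ := left_ne_zero_of_mul hpos.ne'
    have hδ := right_ne_zero_of_mul hpos.ne'
    have hint := hasKetIntegral_integrand2 hd j hpos hρ
    obtain ⟨hN, hnorm, hket⟩ := normalize_gaussComb (by positivity) (by positivity)
      (by positivity) (by positivity) hint.ketIntegral_eq
    rw [div_div] at hket
    exact ⟨by rwa [unnormalized2, hint.ketIntegral_eq], hN, hnorm, hket,
      fun q => sqrt_mul_conv_eq_theta_smeared hd j hN q hpos hne⟩
  · have hsum := hasSum_term3 hd j hβ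
    obtain ⟨hN, hnorm, hket⟩ := normalize_gaussComb (by positivity) (tanh_pos hβ)
      (by positivity) (by positivity) hsum.tsum_eq
    rw [div_div] at hket
    exact ⟨hsum.summable, hN, hnorm, hket,
      fun q => sqrt_mul_conv_eq_theta_damped hd j hN q hβ⟩

theorem proposition1 (d j : ℕ) (hj : j < d) :
    -- Approximation 1
    (∀ κ Δ : ℝ, 0 < κ → 0 < Δ →
      Summable (GKP.term1 d j κ Δ) ∧ 0 < GKP.N1 d j κ Δ ∧ ‖GKP.ket1 d j κ Δ‖ = 1 ∧
      (∀ᵐ q : ℝ, GKP.ket1 d j κ Δ q =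
        ((√(2 * √(Real.pi * Δ ^ 2) / GKP.N1 d j κ Δ) *
          GKP.conv (GKP.combE (1 / κ ^ 2) (GKP.alphaD d * d) (j / d)) (GKP.gauss (Δ ^ 2)) q : ℝ) :
          ℂ)) ∧
      (∀ q : ℝ,
        ((√(2 * √(Real.pi * Δ ^ 2) / GKP.N1 d j κ Δ) *
          GKP.conv (GKP.combE (1 / κ ^ 2) (GKP.alphaD d * d) (j / d)) (GKP.gauss (Δ ^ 2)) q : ℝ) :
          ℂ) =
        ((√(2 * √(Real.pi * Δ ^ 2) / (κ ^ 2 * d * GKP.N1 d j κ Δ)) *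
          GKP.gauss ((1 + κ ^ 2 * Δ ^ 2) / κ ^ 2) q : ℝ) : ℂ) *
          GKP.theta 0 (j / d) ((-(q / (GKP.alphaD d * d * (1 + κ ^ 2 * Δ ^ 2))) : ℝ) : ℂ)
            (Complex.I * ((Δ ^ 2 / (d * (1 + κ ^ 2 * Δ ^ 2)) : ℝ) : ℂ)))) ∧
    -- Approximation 2
    (∀ γ δ : ℝ, 0 < γ * δ → γ * δ < 2 →
      GKP.HasKetIntegral (GKP.integrand2 d j γ δ) (GKP.unnormalized2 d j γ δ) ∧
      0 < GKP.N2 d j γ δ ∧ ‖GKP.ket2 d j γ δ‖ = 1 ∧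
      (∀ᵐ q : ℝ, GKP.ket2 d j γ δ q =
        ((√(GKP.alphaD d * d / (GKP.lam γ δ * GKP.N2 d j γ δ)) *
          GKP.conv
            (GKP.combE
              (GKP.lam γ δ / γ ^ 2 * (1 - γ ^ 2 * δ ^ 2 / (2 * GKP.lam γ δ)) ^ 2)
              (GKP.alphaD d * d * (1 - γ ^ 2 * δ ^ 2 / (2 * GKP.lam γ δ)))
              (j / d))
            (GKP.gauss (δ ^ 2 / GKP.lam γ δ)) q : ℝ) : ℂ)) ∧
      (∀ q : ℝ,
        ((√(GKP.alphaD d * d / (GKP.lam γ δ * GKP.N2 d j γ δ)) *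
          GKP.conv
            (GKP.combE
              (GKP.lam γ δ / γ ^ 2 * (1 - γ ^ 2 * δ ^ 2 / (2 * GKP.lam γ δ)) ^ 2)
              (GKP.alphaD d * d * (1 - γ ^ 2 * δ ^ 2 / (2 * GKP.lam γ δ)))
              (j / d))
            (GKP.gauss (δ ^ 2 / GKP.lam γ δ)) q : ℝ) : ℂ) =
        ((√(GKP.alphaD d * (γ ^ 2)⁻¹ / GKP.N2 d j γ δ) *
          GKP.gauss (GKP.lam γ δ / γ ^ 2) q : ℝ) : ℂ) *
          GKP.theta 0 (j / d)
            ((-(q / (GKP.alphaD d * d) * (1 - γ ^ 2 * δ ^ 2 / (2 * GKP.lam γ δ))) : ℝ) : ℂ)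
            (Complex.I * ((δ ^ 2 / (d * GKP.lam γ δ) : ℝ) : ℂ)))) ∧
    -- Approximation 3
    (∀ β : ℝ, 0 < β →
      Summable (GKP.term3 d j β) ∧ 0 < GKP.N3 d j β ∧ ‖GKP.ket3 d j β‖ = 1 ∧
      (∀ᵐ q : ℝ, GKP.ket3 d j β q =
        ((√(GKP.alphaD d * d / (Real.cosh β * GKP.N3 d j β)) *
          GKP.conv
            (GKP.combE (1 / (Real.sinh β * Real.cosh β)) (GKP.alphaD d * d / Real.cosh β) (j / d))
            (GKP.gauss (Real.tanh β)) q : ℝ) : ℂ)) ∧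
      (∀ q : ℝ,
        ((√(GKP.alphaD d * d / (Real.cosh β * GKP.N3 d j β)) *
          GKP.conv
            (GKP.combE (1 / (Real.sinh β * Real.cosh β)) (GKP.alphaD d * d / Real.cosh β) (j / d))
            (GKP.gauss (Real.tanh β)) q : ℝ) : ℂ) =
        ((√(GKP.alphaD d / (Real.sinh β * GKP.N3 d j β)) *
          GKP.gauss (1 / Real.tanh β) q : ℝ) : ℂ) *
          GKP.theta 0 (j / d)
            ((-(q / (GKP.alphaD d * d * Real.cosh β)) : ℝ) : ℂ)
            (Complex.I * ((Real.tanh β / d : ℝ) : ℂ)))) := by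
  have h := proposition1_general d j (j.zero_le.trans_lt hj)
  exact ⟨fun κ Δ hκ => h.1 κ Δ hκ.ne', fun γ δ h0 h2 => h.2.1 γ δ h0 h2.ne, h.2.2⟩
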